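/- **Setting.** Write $\mathbb N=\{1,2,\dots\}$ and $\mathbb N_0=\mathbb N\cup\{0\}$. A *dilation datum* is a tuple $(G,d,(D_\lambda)_{\lambda>0},\Gamma,V)$ where $G$ is a $1$-connected, locally compact, second countable Hausdorff group; $d$ is a proper left-invariant metric inducing its topology; $(D_\lambda)_{\lambda>0}$ is a one-parameter group of automorphisms of $G$ ($D_{\lambda\mu}=D_\lambda D_\mu$) with $d(D_\lambda(g),D_\lambda(h))=\lambda\, d(g,h)$; $\Gamma<G$ is a uniform (i.e. discrete and cocompact) lattice with $D_\lambda[\Gamma]\subseteq\Gamma$ for some $\lambda>1$; and $V\subseteq G$ is a relatively compact Borel set with $e$ in its interior and $G=\bigsqcup_{\gamma\in\Gamma}\gamma V$. For $\lambda>1$ and $\emptyset\ne M\subseteq\Gamma$ put $V_\lambda(0,M)=MV$ and $V_\lambda(n,M)=D_\lambda[(V_\lambda(n-1,M)\cap\Gamma)V]$ for $n\in\mathbb N$. A *stretch factor* is a $\lambda_0>1$ with $D_{\lambda_0}[\Gamma]\subseteq\Gamma$ for which there are $C_->0$, $s\in\mathbb N_0$, $z\in\Gamma$ with $D_{\lambda_0}^n[\{g\in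 G: d(g,z)<C_-\}]\subseteq V_{\lambda_0}(s+n,\{e\})$ for all $n\in\mathbb N$. Given $\lambda_0$, write $D=D_{\lambda_0}$ and $V(n,M)=V_{\lambda_0}(n,M)$, and let $B(e,r)=\{\gamma\in\Gamma: d(\gamma,e)<r\}$. Let $\mathcal A$ be a finite set. $\Gamma$ acts on $\mathcal A^\Gamma$ by $(\gamma\omega)(\eta)=\omega(\gamma^{-1}\eta)$, and $\mathrm{Orb}(\omega)=\{\gamma\omega:\gamma\in\Gamma\}$. The space $\mathcal A^\Gamma$ carries the metric $\inf\{\frac1{r+1}: r\ge 0,\ \omega|_{B(e,r)}=\rho|_{B(e,r)}\}$, which induces the product topology; $\delta_H$ is the corresponding Hausdorff metric. A *patch* is a map $P:M\to\mathcal A$ with $M\subseteq\Gamma$; it is a *subpatch* of $Q:K\to\mathcal A$, $P\prec Q$, if for some $\gamma\in\Gamma$ we have $\gamma M\subseteq K$ and $Q(\gamma\eta)=P(\eta)$ for all $\eta\in M$. $W(\omega)$ is the set of finite subpatches of $\omega$, and $W(\omega)_M=W(\omega)\cap\mathcal A^M$. Letters are identified with patches supported on $\{e\}$. A *substitution* on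 $\mathcal A^\Gamma$ is given by a dilation datum, a stretch factor $\lambda_0$ and a map $S_0:\mathcal A\to\mathcal A^{D[V]\cap\Gamma}$. Its *substitution map* $S$ acts letterwise on patches (in particular on $\mathcal A^\Gamma$): every element of $\Gamma$ is uniquely $D(\gamma)k$ with $\gamma\in\Gamma$, $k\in D[V]\cap\Gamma$, and $S(P)(D(\gamma)k)=S_0(P(\gamma))(k)$ for $\gamma\in\mathrm{supp}\,P$. A finite patch $P$ is *legal* if $P\prec S^n(a)$ for some $n\in\mathbb N$, $a\in\mathcal A$; $W(S)$ is the set of legal patches and $\Omega(S)=\{\omega\in\mathcal A^\Gamma: W(\omega)\subseteq W(S)\}$. The substitution is *primitive* if there is $L\in\mathbb N$ with $a\prec S^L(b)$ for all $a,b\in\mathcal A$. A pair $(T,N_T)$ with $T\subseteq\Gamma$ finite is a *testing tuple* if (a) for every $r>0$ there is $N_r\ge0$ such that for all $n\ge N_r$ and $x\in\Gamma$ there is $\gamma\in\Gamma$ with $xB(e,r)\subseteq D^n(\gamma)V(n,T)$, and (b) $N_T$ is the smallest $m\in\mathbb N$ such that for every $x\in\Gamma$ there is $\gamma_x\in\Gamma$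 with $xT\subseteq D^m(\gamma_x)V(m,T)$. The *substitution graph* $G_S(T,N_T)$ is the directed graph with vertex set $\mathcal A^T$ and an edge from $P$ to $Q$ iff $Q\prec S^{N_T}(P)$ and $P,Q\notin W(S)$. A *path* of length $\ell\in\mathbb N$ is a tuple $(v_0,\dots,v_\ell)$ with an edge from $v_j$ to $v_{j+1}$ for $0\le j<\ell$; it is *closed* if $v_0=v_\ell$. A *Schrödinger operator with finite range* is a family $H=(H_\omega)_{\omega\in\mathcal A^\Gamma}$ of self-adjoint operators on $\ell^2(\Gamma)$ of the form $(H_\omega\psi)(\gamma)=\sum_{\eta\in B}t_\eta(\gamma^{-1}\omega)\psi(\gamma\eta)$, where $B=B^{-1}\subseteq\Gamma$ is finite and the functions $t_\eta:\mathcal A^\Gamma\to\mathbb C$, $\eta\in B$, are continuous with $t_\eta(\omega)=\overline{t_{\eta^{-1}}(\eta^{-1}\omega)}$. **Theorem.** Consider a primitive substitution on $\mathcal A^\Gamma$ with substitution map $S$, a testing tuple $(T,N_T)$ and $\omega_0\in\mathcal A^\Gamma$. The following are equivalent. (i) For every Schrödinger operator $H$ with finite range and every $\omega\in\Omega(S)$,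 $\lim_{n\to\infty}\sigma(H_{S^n(\omega_0)})=\sigma(H_\omega)$ in the Hausdorff metric on nonempty compact subsets of $\mathbb R$. (ii) $\lim_{n\to\infty}\delta_H\big(\overline{\mathrm{Orb}(S^n(\omega_0))},\Omega(S)\big)=0$. (iii) No directed path in $G_S(T,N_T)$ starting in a vertex of $W(\omega_0)_T$ contains a closed subpath. (iv) Every directed path in $G_S(T,N_T)$ starting in a vertex of $W(\omega_0)_T$ has length strictly less than $|\mathcal A^T|$. In particular, if $W(\omega_0)_T\subseteq W(S)$, then these equivalent conditions are satisfied. -/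

import Mathlib

open Set Filter Topology
open scoped Pointwise ENNReal ComplexConjugate

noncomputable section

namespace SubstLattice

universe u v w

/-! ### Configurations over a group -/

section Configurations

variable {Γ : Type u} {A : Type v} [Group Γ]

/-- The left translation action `(γ ω)(η) = ω (γ⁻¹ η)` on configurations `ω : Γ → A`. -/
def translate (γ : Γ) (ω : Γ → A) : Γ → A := fun η => ω (γ⁻¹ * η)

/-- The orbit of a configuration. -/
def orbit (ω : Γ → A) : Set (Γ → A) := range fun γ : Γ => translate γ ω

/-- The set of all `1 / (r + 1)`, `r ≥ 0`, such that `ω` and `ρ` agree on the open ball of radius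
`r` around the neutral element. -/
def agreeSet [PseudoMetricSpace Γ] (ω ρ : Γ → A) : Set ℝ :=
  {x | ∃ r : ℝ, 0 ≤ r ∧ (∀ γ ∈ Metric.ball (1 : Γ) r, ω γ = ρ γ) ∧ x = 1 / (r + 1)}

lemma agreeSet_nonempty [PseudoMetricSpace Γ] (ω ρ : Γ → A) : (agreeSet ω ρ).Nonempty :=
  ⟨1 / (0 + 1), 0, le_rfl, by simp, rfl⟩

lemma agreeSet_pos [PseudoMetricSpace Γ] {ω ρ : Γ → A} {x : ℝ} (hx : x ∈ agreeSet ω ρ) :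
    0 < x := by
  obtain ⟨r, hr, -, rfl⟩ := hx
  positivity

lemma agreeSet_bddBelow [PseudoMetricSpace Γ] (ω ρ : Γ → A) : BddBelow (agreeSet ω ρ) :=
  ⟨0, fun _ hx => (agreeSet_pos hx).le⟩

/-- The metric `inf {1 / (r + 1) | r ≥ 0, ω = ρ on B(e, r)}` on the configuration space. -/
abbrev configMetric (Γ : Type u) (A : Type v) [Group Γ] [MetricSpace Γ] : MetricSpace (Γ → A) where
  dist ω ρ := sInf (agreeSet ω ρ)
  dist_self ω := by
    apply le_antisymm
    · refine le_of_forall_pos_le_add fun ε hε => ?_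
      have h : 1 / (1 / ε + 1) ∈ agreeSet ω ω := ⟨1 / ε, by positivity, by simp, rfl⟩
      refine (csInf_le (agreeSet_bddBelow ω ω) h).trans ?_
      rw [zero_add, div_le_iff₀ (by positivity)]
      have : ε * (1 / ε + 1) = 1 + ε := by field_simp
      linarith
    · exact le_csInf (agreeSet_nonempty ω ω) fun _ hx => (agreeSet_pos hx).le
  dist_comm ω ρ := by
    have : agreeSet ω ρ = agreeSet ρ ω := by
      ext x
      simp only [agreeSet, mem_ofPred_eq, eq_comm]
    rw [this]
  dist_triangle ω ρ τ := by
    rw [← sub_le_iff_le_add]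
    refine le_csInf (agreeSet_nonempty _ _) fun y hy => ?_
    rw [sub_le_comm]
    refine le_csInf (agreeSet_nonempty _ _) fun x hx => ?_
    rw [sub_le_iff_le_add]
    have hx0 := agreeSet_pos hx
    have hy0 := agreeSet_pos hy
    obtain ⟨r, hr, hrr, rfl⟩ := hx
    obtain ⟨s, hs, hss, rfl⟩ := hy
    rcases le_total r s with h | h
    · refine (csInf_le (agreeSet_bddBelow _ _) ⟨r, hr, fun γ hγ => ?_, rfl⟩).trans
        (le_add_of_nonneg_right hy0.le)
      exact (hss γ (Metric.ball_subset_ball h hγ)).trans (hrr γ hγ)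
    · refine (csInf_le (agreeSet_bddBelow _ _) ⟨s, hs, fun γ hγ => ?_, rfl⟩).trans
        (le_add_of_nonneg_left hx0.le)
      exact (hss γ hγ).trans (hrr γ (Metric.ball_subset_ball h hγ))
  eq_of_dist_eq_zero {ω ρ} h := by
    by_contra hne
    obtain ⟨γ, hγ⟩ := Function.ne_iff.mp hne
    have : 1 / (dist γ 1 + 1) ≤ sInf (agreeSet ω ρ) := by
      refine le_csInf (agreeSet_nonempty _ _) fun x hx => ?_
      obtain ⟨r, hr, hrr, rfl⟩ := hx
      have : r ≤ dist γ 1 := by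
        by_contra hlt
        exact hγ (hrr γ (by simpa [Metric.mem_ball] using hlt))
      gcongr
    have h0 : 0 < 1 / (dist γ (1 : Γ) + 1) := by positivity
    change sInf (agreeSet ω ρ) = 0 at h
    linarith

/-- The Hausdorff distance on sets of configurations induced by `configMetric` (with values in
`[0, ∞]`; it is a genuine finite distance between nonempty sets). -/
def subshiftDist [MetricSpace Γ] (Ω₁ Ω₂ : Set (Γ → A)) : ℝ≥0∞ :=
  letI := configMetric Γ A
  Metric.hausdorffEDist Ω₁ Ω₂

/-! ### Patches -/

/-- A patch is a map `P : M → A` on some `M ⊆ Γ`; it is encoded as a partial function, with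
`P γ = none` exactly if `γ` is not in the support `M`. -/
abbrev Patch (Γ : Type u) (A : Type v) := Γ → Option A

/-- The support of a patch. -/
def Patch.supp (P : Patch Γ A) : Set Γ := {γ | P γ ≠ none}

/-- A configuration as a patch with support `Γ`. -/
def configPatch (ω : Γ → A) : Patch Γ A := fun γ => some (ω γ)

open Classical in
/-- A map `P : K → A` on a finite set `K` as a patch with support `K`. -/
def finPatch {K : Finset Γ} (P : K → A) : Patch Γ A :=
  fun γ => if h : γ ∈ K then some (P ⟨γ, h⟩) else none

open Classical in
/-- A letter, identified with a patch supported on the neutral element. -/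
def letterPatch (a : A) : Patch Γ A := fun γ => if γ = 1 then some a else none

/-- The subpatch relation `P ≺ Q`: for some `γ`, `γ supp P ⊆ supp Q` and `Q (γ η) = P η` for all
`η` in the support of `P`. -/
def IsSubpatch (P Q : Patch Γ A) : Prop :=
  ∃ γ : Γ, ∀ η ∈ P.supp, γ * η ∈ Q.supp ∧ Q (γ * η) = P η

/-- The dictionary `W(ω)`: all finite subpatches of `ω`. -/
def dictionary (ω : Γ → A) : Set (Patch Γ A) :=
  {P | P.supp.Finite ∧ IsSubpatch P (configPatch ω)}

/-- `W(ω)_K`: the elements of the dictionary of `ω` with support `K`, as elements of `A^K`. -/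
def dictionaryOn (ω : Γ → A) (K : Finset Γ) : Set (K → A) := {P | finPatch P ∈ dictionary ω}

end Configurations

/-! ### Schrödinger operators with finite range -/

section Schrodinger

/-- The data of a Schrödinger operator with finite range over `A^Γ`. -/
structure SchrodingerOperator (Γ : Type u) (A : Type v) [Group Γ] [TopologicalSpace A] where
  /-- The finite range `B`. -/
  range : Finset Γ
  inv_mem : ∀ η ∈ range, η⁻¹ ∈ range
  /-- The coefficients `t_η`; only those with `η ∈ B` matter. -/
  coeff : Γ → (Γ → A) → ℂ
  continuous_coeff : ∀ η ∈ range, Continuous (coeff η)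
  coeff_symm : ∀ η ∈ range, ∀ ω, coeff η ω = conj (coeff η⁻¹ (translate η⁻¹ ω))

namespace SchrodingerOperator

variable {Γ : Type u} {A : Type v} [Group Γ] [TopologicalSpace A]

/-- The formula `(H_ω ψ)(γ) = ∑ η ∈ B, t_η(γ⁻¹ ω) ψ(γ η)`. -/
def formula (H : SchrodingerOperator Γ A) (ω : Γ → A) (ψ : Γ → ℂ) : Γ → ℂ :=
  fun γ => ∑ η ∈ H.range, H.coeff η (translate γ⁻¹ ω) * ψ (γ * η)

lemma memℓp_formula [Finite A] (H : SchrodingerOperator Γ A) (ω : Γ → A)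
    (ψ : lp (fun _ : Γ => ℂ) 2) : Memℓp (H.formula ω ψ) 2 := by
  have key : ∀ η ∈ H.range,
      Memℓp (fun γ => H.coeff η (translate γ⁻¹ ω) * ψ (γ * η)) 2 := by
    intro η hη
    obtain ⟨C, hC⟩ := isCompact_univ.exists_bound_of_continuousOn
      (H.continuous_coeff η hη).continuousOn
    have h2 : (0 : ℝ) < (2 : ℝ≥0∞).toReal := by norm_num
    have hψ : Memℓp (fun γ => ψ (γ * η)) 2 := by
      refine memℓp_gen ?_
      exact (lp.memℓp ψ |>.summable h2).comp_injective (mul_left_injective η)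
    have hCψ : Memℓp (fun γ => (C : ℂ) * ψ (γ * η)) 2 := hψ.const_mul (C : ℂ)
    refine memℓp_gen (Summable.of_nonneg_of_le (fun _ => by positivity) (fun γ => ?_)
      (hCψ.summable h2))
    have hle : ‖H.coeff η (translate γ⁻¹ ω)‖ ≤ C := hC _ (mem_univ _)
    have hC0 : 0 ≤ C := (norm_nonneg _).trans hle
    rw [norm_mul, norm_mul, Complex.norm_real, Real.norm_of_nonneg hC0]
    gcongr
  have := Memℓp.finsetSum H.range key
  exact this

/-- The linear operator `H_ω` on `ℓ²(Γ)`. -/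
def linearOp [Finite A] (H : SchrodingerOperator Γ A) (ω : Γ → A) :
    lp (fun _ : Γ => ℂ) 2 →ₗ[ℂ] lp (fun _ : Γ => ℂ) 2 where
  toFun ψ := ⟨H.formula ω ψ, H.memℓp_formula ω ψ⟩
  map_add' ψ φ := by
    ext γ
    change H.formula ω _ γ = H.formula ω _ γ + H.formula ω _ γ
    simp [formula, mul_add, Finset.sum_add_distrib]
  map_smul' c ψ := by
    ext γ
    change H.formula ω _ γ = c * H.formula ω _ γ
    simp only [formula, lp.coeFn_smul, Pi.smul_apply, smul_eq_mul, Finset.mul_sum]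
    exact Finset.sum_congr rfl fun _ _ => by ring

/-- The bounded operator `H_ω` on `ℓ²(Γ)`. -/
def op [Finite A] (H : SchrodingerOperator Γ A) (ω : Γ → A) :
    lp (fun _ : Γ => ℂ) 2 →L[ℂ] lp (fun _ : Γ => ℂ) 2 where
  toLinearMap := H.linearOp ω
  cont := by
    have hev : ∀ γ : Γ, Continuous fun ψ : lp (fun _ : Γ => ℂ) 2 => ψ γ := fun γ =>
      (lp.evalCLM ℂ (fun _ : Γ => ℂ) 2 γ).continuous
    refine (H.linearOp ω).continuous_of_seq_closed_graph fun ψ x y hψ hy => ?_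
    ext γ
    have h1 : Tendsto (fun n => H.linearOp ω (ψ n) γ) atTop (𝓝 (y γ)) :=
      ((hev γ).tendsto y).comp hy
    have h2 : Tendsto (fun n => H.linearOp ω (ψ n) γ) atTop (𝓝 (H.linearOp ω x γ)) :=
      tendsto_finsetSum _ fun η _ => (((hev (γ * η)).tendsto x).comp hψ).const_mul _
    exact tendsto_nhds_unique h1 h2

lemma op_apply [Finite A] (H : SchrodingerOperator Γ A) (ω : Γ → A)
    (ψ : lp (fun _ : Γ => ℂ) 2) (γ : Γ) :
    H.op ω ψ γ = ∑ η ∈ H.range, H.coeff η (translate γ⁻¹ ω) * ψ (γ * η) := rfl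

open Classical in
lemma isSelfAdjoint_op [Finite A] (H : SchrodingerOperator Γ A) (ω : Γ → A) :
    IsSelfAdjoint (H.op ω) := by
  rw [ContinuousLinearMap.isSelfAdjoint_iff']
  ext φ γ
  have h1 : (ContinuousLinearMap.adjoint (H.op ω) φ) γ
      = inner ℂ (H.op ω (lp.single 2 γ (1 : ℂ))) φ := by
    rw [← ContinuousLinearMap.adjoint_inner_right, lp.inner_single_left]
    simp
  have h2 : H.op ω (lp.single 2 γ (1 : ℂ))
      = ∑ η ∈ H.range, lp.single 2 (γ * η⁻¹) (H.coeff η (translate (γ * η⁻¹)⁻¹ ω)) := by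
    ext ξ
    rw [op_apply, lp.coeFn_sum, Finset.sum_apply]
    refine Finset.sum_congr rfl fun η _ => ?_
    by_cases h : ξ = γ * η⁻¹
    · subst h
      simp
    · have h' : ξ * η ≠ γ := fun h'' => h (by rw [← h'']; simp)
      rw [lp.single_apply_ne _ _ _ h', lp.single_apply_ne _ _ _ h, mul_zero]
  rw [h1, h2, sum_inner, op_apply]
  refine Finset.sum_nbij' (fun η => η⁻¹) (fun η => η⁻¹) H.inv_mem H.inv_mem (by simp) (by simp) ?_
  intro η hη
  rw [lp.inner_single_left, H.coeff_symm η⁻¹ (H.inv_mem η hη)]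
  have : translate η⁻¹⁻¹ (translate γ⁻¹ ω) = translate (γ * η⁻¹)⁻¹ ω := by
    funext ξ
    simp [translate, mul_assoc]
  rw [this]
  simp [mul_comm]

/-- The spectrum of the (self-adjoint) operator `H_ω`, as a subset of `ℝ`. -/
def spec [Finite A] (H : SchrodingerOperator Γ A) (ω : Γ → A) : Set ℝ :=
  {E : ℝ | (E : ℂ) ∈ spectrum ℂ (H.op ω)}

end SchrodingerOperator

end Schrodinger

/-! ### Dilation data -/

/-- A dilation datum `(G, d, (D_s)_{s > 0}, Γ, V)`. The metric `d` is the one of the instance on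
`G`, and it induces the topology of `G`. A proper metric space is automatically locally compact,
second countable and Hausdorff. The values of `dil` at nonpositive reals play no role. -/
structure DilationDatum (G : Type u) [Group G] [MetricSpace G] where
  isTopologicalGroup : IsTopologicalGroup G
  /-- `G` is `1`-connected. -/
  simplyConnected : SimplyConnectedSpace G
  proper : ProperSpace G
  dist_mul_left : ∀ g h k : G, dist (g * h) (g * k) = dist h k
  /-- The dilation family, a one-parameter group of automorphisms. -/
  dil : ℝ → G ≃* G
  dil_mul : ∀ s t : ℝ, 0 < s → 0 < t → ∀ g, dil (s * t) g = dil s (dil t g)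
  dist_dil : ∀ s : ℝ, 0 < s → ∀ g h, dist (dil s g) (dil s h) = s * dist g h
  /-- The uniform lattice `Γ`. -/
  lattice : Subgroup G
  discrete : DiscreteTopology lattice
  cocompact : CompactSpace (G ⧸ lattice)
  exists_dil_lattice : ∃ s : ℝ, 1 < s ∧ ∀ γ ∈ lattice, dil s γ ∈ lattice
  /-- The fundamental domain `V`. -/
  V : Set G
  measurable_V : @MeasurableSet G (borel G) V
  relCompact_V : IsCompact (closure V)
  /-- `G` is the disjoint union of the translates `γ V`, `γ ∈ Γ`. -/
  fundamental : ∀ g : G, ∃! γ : lattice, (γ : G)⁻¹ * g ∈ V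
  one_mem_interior : (1 : G) ∈ interior V

namespace DilationDatum

variable {G : Type u} [Group G] [MetricSpace G] (𝒟 : DilationDatum G)

/-- The sets `V_s(n, M)`: `V_s(0, M) = M V` and `V_s(n + 1, M) = D_s[(V_s(n, M) ∩ Γ) V]`. -/
def inflate (s : ℝ) : ℕ → Set 𝒟.lattice → Set G
  | 0, M => ((↑) '' M : Set G) * 𝒟.V
  | n + 1, M => 𝒟.dil s '' ((inflate s n M ∩ (𝒟.lattice : Set G)) * 𝒟.V)

/-- `s` is a stretch factor associated with the dilation datum: `D_s[Γ] ⊆ Γ`, and `s` is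
sufficiently large relative to `V`. The ball is an open ball in `G`. -/
structure IsStretchFactor (s : ℝ) : Prop where
  one_lt : 1 < s
  dil_mem : ∀ γ ∈ 𝒟.lattice, 𝒟.dil s γ ∈ 𝒟.lattice
  large : ∃ C : ℝ, 0 < C ∧ ∃ (m : ℕ) (z : 𝒟.lattice), ∀ n : ℕ, 1 ≤ n →
    (𝒟.dil s)^[n] '' Metric.ball (z : G) C ⊆ 𝒟.inflate s (m + n) {1}

/-- Condition on `m` in a testing tuple: every translate `x T` is contained in some
`D_s^m(γ) V_s(m, T)`. -/
def Covers (s : ℝ) (T : Finset 𝒟.lattice) (m : ℕ) : Prop :=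
  ∀ x : 𝒟.lattice, ∃ γ : 𝒟.lattice,
    (x : G) • ((↑) '' (T : Set 𝒟.lattice) : Set G) ⊆
      ((𝒟.dil s)^[m] (γ : G)) • 𝒟.inflate s m T

/-- `(T, N)` is a testing tuple for the dilation datum and the stretch factor `s`. The balls are
open balls in `Γ`. -/
structure IsTestingTuple (s : ℝ) (T : Finset 𝒟.lattice) (N : ℕ) : Prop where
  testing : ∀ r : ℝ, 0 < r → ∃ Nr : ℕ, ∀ n : ℕ, Nr ≤ n → ∀ x : 𝒟.lattice, ∃ γ : 𝒟.lattice,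
    (x : G) • ((↑) '' Metric.ball (1 : 𝒟.lattice) r : Set G) ⊆
      ((𝒟.dil s)^[n] (γ : G)) • 𝒟.inflate s n T
  isLeast : IsLeast {m : ℕ | 1 ≤ m ∧ 𝒟.Covers s T m} N

/-- The unique lattice element `γ` with `g ∈ γ V`. -/
def cell (g : G) : 𝒟.lattice := (𝒟.fundamental g).choose

lemma cell_spec (g : G) : (𝒟.cell g : G)⁻¹ * g ∈ 𝒟.V := (𝒟.fundamental g).choose_spec.1

end DilationDatum

/-! ### Substitutions -/

/-- A substitution datum over a dilation datum with alphabet `A`: a stretch factor and a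
substitution rule `S₀ : A → A^{D[V] ∩ Γ}`. -/
structure SubstitutionDatum {G : Type u} [Group G] [MetricSpace G] (𝒟 : DilationDatum G)
    (A : Type v) where
  /-- The stretch factor. -/
  stretch : ℝ
  isStretchFactor : 𝒟.IsStretchFactor stretch
  /-- The substitution rule. -/
  rule : A → {k : 𝒟.lattice // (k : G) ∈ 𝒟.dil stretch '' 𝒟.V} → A

namespace SubstitutionDatum

variable {G : Type u} [Group G] [MetricSpace G] {𝒟 : DilationDatum G} {A : Type v}
  (𝒮 : SubstitutionDatum 𝒟 A)

/-- The dilation `D : Γ → Γ` by the stretch factor. -/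
def dilLattice (γ : 𝒟.lattice) : 𝒟.lattice :=
  ⟨𝒟.dil 𝒮.stretch γ, 𝒮.isStretchFactor.dil_mem γ γ.2⟩

/-- Every `g ∈ Γ` is uniquely of the form `g = D(γ) k` with `γ ∈ Γ` and `k ∈ D[V] ∩ Γ`;
this is `γ`. -/
def parent (g : 𝒟.lattice) : 𝒟.lattice := 𝒟.cell ((𝒟.dil 𝒮.stretch).symm (g : G))

/-- Every `g ∈ Γ` is uniquely of the form `g = D(γ) k` with `γ ∈ Γ` and `k ∈ D[V] ∩ Γ`;
this is `k`. -/
def offset (g : 𝒟.lattice) : {k : 𝒟.lattice // (k : G) ∈ 𝒟.dil 𝒮.stretch '' 𝒟.V} :=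
  ⟨(𝒮.dilLattice (𝒮.parent g))⁻¹ * g,
    ⟨_, 𝒟.cell_spec ((𝒟.dil 𝒮.stretch).symm (g : G)), by simp [dilLattice, parent]⟩⟩

/-- The substitution map on patches, acting letterwise: `S(P)(D(γ) k) = S₀(P(γ))(k)` for `γ` in the
support of `P` and `k ∈ D[V] ∩ Γ`. -/
def substPatch (P : Patch 𝒟.lattice A) : Patch 𝒟.lattice A :=
  fun g => (P (𝒮.parent g)).map fun a => 𝒮.rule a (𝒮.offset g)

/-- The substitution map on configurations: `S(ω)(D(γ) k) = S₀(ω(γ))(k)`. -/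
def substConfig (ω : 𝒟.lattice → A) : 𝒟.lattice → A :=
  fun g => 𝒮.rule (ω (𝒮.parent g)) (𝒮.offset g)

lemma substPatch_configPatch (ω : 𝒟.lattice → A) :
    𝒮.substPatch (configPatch ω) = configPatch (𝒮.substConfig ω) := rfl

/-- The set `W(S)` of legal patches. -/
def legal : Set (Patch 𝒟.lattice A) :=
  {P | P.supp.Finite ∧
    ∃ n : ℕ, 1 ≤ n ∧ ∃ a : A, IsSubpatch P (𝒮.substPatch^[n] (letterPatch a))}

/-- The subshift `Ω(S)`. -/
def subshift : Set (𝒟.lattice → A) := {ω | dictionary ω ⊆ 𝒮.legal}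

/-- Primitivity of the substitution. -/
def IsPrimitive : Prop :=
  ∃ L : ℕ, 1 ≤ L ∧ ∀ a b : A, IsSubpatch (letterPatch a) (𝒮.substPatch^[L] (letterPatch b))

/-- The substitution graph `G_S(K; n)` on the vertex set `A^K`. -/
def graph (K : Finset 𝒟.lattice) (n : ℕ) : Digraph (K → A) where
  Adj P Q := IsSubpatch (finPatch Q) (𝒮.substPatch^[n] (finPatch P)) ∧
    finPatch P ∉ 𝒮.legal ∧ finPatch Q ∉ 𝒮.legal

end SubstitutionDatum

/-! ### Paths in directed graphs -/

section Paths

variable {X : Type w}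

/-- `(p 0, …, p ℓ)` is a directed path of length `ℓ ≥ 1`. -/
def IsPath (Gr : Digraph X) {l : ℕ} (p : Fin (l + 1) → X) : Prop :=
  1 ≤ l ∧ ∀ i : Fin l, Gr.Adj (p i.castSucc) (p i.succ)

/-- `(q 0, …, q m)` is a subpath of `(p 0, …, p ℓ)`. -/
def IsSubpath {m l : ℕ} (q : Fin (m + 1) → X) (p : Fin (l + 1) → X) : Prop :=
  ∃ (i : ℕ) (h : i + m ≤ l), ∀ j : Fin (m + 1), q j = p ⟨i + j, by omega⟩

/-- `(p 0, …, p ℓ)` has a closed subpath. -/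
def HasClosedSubpath (Gr : Digraph X) {l : ℕ} (p : Fin (l + 1) → X) : Prop :=
  ∃ (m : ℕ) (q : Fin (m + 1) → X), IsPath Gr q ∧ q 0 = q (Fin.last m) ∧ IsSubpath q p

end Paths

/-! ### The four conditions -/

namespace SubstitutionDatum

variable {G : Type u} [Group G] [MetricSpace G] {𝒟 : DilationDatum G} {A : Type v}
  (𝒮 : SubstitutionDatum 𝒟 A)

/-- For every Schrödinger operator with finite range, the spectra along `S^n(ω₀)` converge in the
Hausdorff metric to the spectrum of `H_ω`, for every `ω ∈ Ω(S)`. -/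
def SpectralConvergence [Finite A] [TopologicalSpace A] (ω₀ : 𝒟.lattice → A) : Prop :=
  ∀ H : SchrodingerOperator 𝒟.lattice A, ∀ ω ∈ 𝒮.subshift,
    Tendsto (fun n : ℕ => Metric.hausdorffEDist (H.spec (𝒮.substConfig^[n] ω₀)) (H.spec ω))
      atTop (𝓝 0)

/-- The orbit closures of `S^n(ω₀)` converge to `Ω(S)` in the Hausdorff metric. -/
def SubshiftConvergence [TopologicalSpace A] (ω₀ : 𝒟.lattice → A) : Prop :=
  Tendsto (fun n : ℕ => subshiftDist (closure (orbit (𝒮.substConfig^[n] ω₀))) 𝒮.subshift)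
    atTop (𝓝 0)

/-- No directed path in `G_S(T; N)` starting in `W(ω₀)_T` contains a closed subpath. -/
def NoClosedPaths (T : Finset 𝒟.lattice) (N : ℕ) (ω₀ : 𝒟.lattice → A) : Prop :=
  ∀ (l : ℕ) (p : Fin (l + 1) → (T → A)), IsPath (𝒮.graph T N) p →
    p 0 ∈ dictionaryOn ω₀ T → ¬ HasClosedSubpath (𝒮.graph T N) p

/-- Every directed path in `G_S(T; N)` starting in `W(ω₀)_T` has length less than `|A^T|`. -/
def ShortPaths (T : Finset 𝒟.lattice) (N : ℕ) (ω₀ : 𝒟.lattice → A) : Prop :=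
  ∀ (l : ℕ) (p : Fin (l + 1) → (T → A)), IsPath (𝒮.graph T N) p →
    p 0 ∈ dictionaryOn ω₀ T → l < Nat.card (T → A)

end SubstitutionDatum

end SubstLattice

end

namespace SubstLattice

/-! ### Patches and subpatches -/

section Patches

variable {Γ A : Type*}

/-! All four conditions are tied to `PatchConvergence`: for each finite `F` and all large `n`, the
`F`-patches of `S^n(ω₀)` are exactly the legal ones. By primitivity every legal patch eventually
occurs (`IsPrimitive.eventually_mem_dictionary`) and every element of `Ω(S)` has dictionary `W(S)`
(`IsPrimitive.mem_dictionary`), so the question is whether illegal patches die out.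

Substitution preserves legality, and the covering property of `T` shows that an illegal `T`-patch of
`S^(N k)(ω₀)` descends from an illegal `T`-patch of `S^(N (k-1))(ω₀)`. Illegal patches therefore
trace out paths of the graph starting in `W(ω₀)_T` (`exists_path_of_not_legal`). If these are
shorter than `|A^T|`, then all `T`-patches of `S^(N |A^T|)(ω₀)` are legal, and property (a) of the
testing tuple spreads this to every finite set. Conversely, an illegal patch on a closed path
reproduces itself for ever. Pigeonhole links (iii) and (iv).

For spectra, points far from the spectrum of a self-adjoint operator are characterised by lower
bounds for `‖(H - x) ψ‖`. The dilations force at most geometric growth of `Γ` along the radii `s ^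
n`, hence Følner sets, so such bounds can be tested on functions supported in translates of one
finite set (`HasFolnerSets.exists_lower_bound`). There `H_ω` sees only finite patches
(`exists_finset_spec_close`). In the other direction, the indicator potential of a patch has `1` in
its spectrum if the patch occurs and is the zero operator otherwise. -/

lemma finPatch_eq_some {K : Finset Γ} {P : K → A} {γ : Γ} {a : A} :
    finPatch P γ = some a ↔ ∃ h : γ ∈ K, P ⟨γ, h⟩ = a := by
  unfold finPatch
  split_ifs with h <;> simp [h]

lemma finPatch_supp_finite {K : Finset Γ} (P : K → A) : (finPatch P).supp.Finite := by
  refine K.finite_toSet.subset fun γ hγ => ?_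
  obtain ⟨a, ha⟩ := Option.ne_none_iff_exists'.1 hγ
  exact (finPatch_eq_some.1 ha).1

variable [Group Γ]

lemma isSubpatch_iff {P Q : Patch Γ A} :
    IsSubpatch P Q ↔ ∃ γ, ∀ η a, P η = some a → Q (γ * η) = some a := by
  constructor
  · rintro ⟨γ, h⟩
    refine ⟨γ, fun η a ha => ?_⟩
    rw [(h η (by simp [Patch.supp, ha])).2, ha]
  · rintro ⟨γ, h⟩
    refine ⟨γ, fun η hη => ?_⟩
    obtain ⟨a, ha⟩ := Option.ne_none_iff_exists'.1 hη
    have := h η a ha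
    exact ⟨by simp [Patch.supp, this], by rw [this, ha]⟩

lemma IsSubpatch.trans {P Q R : Patch Γ A} (h₁ : IsSubpatch P Q) (h₂ : IsSubpatch Q R) :
    IsSubpatch P R := by
  rw [isSubpatch_iff] at *
  obtain ⟨γ, hγ⟩ := h₁
  obtain ⟨ξ, hξ⟩ := h₂
  exact ⟨ξ * γ, fun η a ha => by rw [mul_assoc]; exact hξ _ _ (hγ _ _ ha)⟩

lemma isSubpatch_finPatch_iff {K : Finset Γ} {P : K → A} {Q : Patch Γ A} :
    IsSubpatch (finPatch P) Q ↔ ∃ γ, ∀ η : K, Q (γ * η) = some (P η) := by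
  rw [isSubpatch_iff]
  refine exists_congr fun γ => ⟨fun h η => h _ _ (finPatch_eq_some.2 ⟨η.2, rfl⟩), ?_⟩
  intro h η a ha
  obtain ⟨hη, rfl⟩ := finPatch_eq_some.1 ha
  exact h ⟨η, hη⟩

lemma mem_dictionaryOn {K : Finset Γ} {P : K → A} {ω : Γ → A} :
    P ∈ dictionaryOn ω K ↔ ∃ γ, ∀ η : K, ω (γ * η) = P η := by
  change _ ∧ _ ↔ _
  rw [isSubpatch_finPatch_iff]
  simp [configPatch, finPatch_supp_finite]

lemma restrict_mem_dictionaryOn (K : Finset Γ) (ω : Γ → A) (γ : Γ) :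
    (fun η : K => ω (γ * η)) ∈ dictionaryOn ω K :=
  mem_dictionaryOn.2 ⟨γ, fun _ => rfl⟩

lemma letterPatch_eq_some {a b : A} {γ : Γ} :
    letterPatch a γ = some b ↔ γ = 1 ∧ a = b := by
  unfold letterPatch
  split_ifs with h <;> simp [h]

lemma isSubpatch_letterPatch_iff {a : A} {Q : Patch Γ A} :
    IsSubpatch (letterPatch a) Q ↔ ∃ γ, Q γ = some a := by
  rw [isSubpatch_iff]
  constructor
  · rintro ⟨γ, h⟩
    exact ⟨γ, by simpa using h 1 a (letterPatch_eq_some.2 ⟨rfl, rfl⟩)⟩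
  · rintro ⟨γ, h⟩
    refine ⟨γ, fun η b hb => ?_⟩
    obtain ⟨rfl, rfl⟩ := letterPatch_eq_some.1 hb
    simpa using h

/-- A configuration all of whose restrictions to finite sets satisfy a property that is inherited by
subpatches has its dictionary in the set of patches with this property. -/
lemma dictionary_subset_of_forall_finPatch {ω : Γ → A} {W : Set (Patch Γ A)}
    (hW : ∀ P Q, P.supp.Finite → IsSubpatch P Q → Q ∈ W → P ∈ W)
    (h : ∀ K : Finset Γ, finPatch (fun η : K => ω η) ∈ W) : dictionary ω ⊆ W := by
  rintro P ⟨hfin, hP⟩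
  rw [isSubpatch_iff] at hP
  obtain ⟨γ, hγ⟩ := hP
  have hK := (hfin.image fun η => γ * η)
  refine hW P _ hfin (isSubpatch_iff.2 ⟨γ, fun η a ha => ?_⟩) (h hK.toFinset)
  refine finPatch_eq_some.2 ⟨?_, ?_⟩
  · simpa [Patch.supp] using fun h0 => by simp [h0] at ha
  · simpa [configPatch] using hγ η a ha

end Patches

/-! ### Geometry of dilation data -/

namespace DilationDatum

variable {G : Type*} [Group G] [MetricSpace G] (𝒟 : DilationDatum G)

lemma cell_eq {g : G} {γ : 𝒟.lattice} (h : (γ : G)⁻¹ * g ∈ 𝒟.V) : 𝒟.cell g = γ :=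
  (𝒟.fundamental g).unique (𝒟.cell_spec g) h

lemma cell_coe (γ : 𝒟.lattice) : 𝒟.cell (γ : G) = γ :=
  𝒟.cell_eq (by simpa using interior_subset 𝒟.one_mem_interior)

lemma cell_coe_mul (γ : 𝒟.lattice) (g : G) : 𝒟.cell (γ * g) = γ * 𝒟.cell g :=
  𝒟.cell_eq (by simpa [mul_assoc] using 𝒟.cell_spec g)

/-- A discrete subgroup is closed, so its trace on a compact ball of the proper space `G` is both
compact and discrete. -/
lemma finite_ball (γ : 𝒟.lattice) (r : ℝ) : (Metric.ball γ r).Finite := by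
  have := 𝒟.isTopologicalGroup
  have := 𝒟.proper
  have := 𝒟.discrete
  have hc : IsClosed (𝒟.lattice : Set G) := Subgroup.isClosed_of_discrete
  have h1 : IsCompact ((↑) ⁻¹' Metric.closedBall (γ : G) r : Set 𝒟.lattice) :=
    hc.isClosedEmbedding_subtypeVal.isCompact_preimage (isCompact_closedBall _ _)
  exact (isCompact_iff_finite.1 h1).subset fun x hx => (Metric.mem_ball.1 hx).le

lemma exists_dist_cell_le : ∃ c : ℝ, ∀ g : G, dist g (𝒟.cell g) ≤ c := by
  obtain ⟨c, hc⟩ := (𝒟.relCompact_V.isBounded.subset subset_closure).subset_closedBall 1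
  refine ⟨c, fun g => ?_⟩
  have := hc (𝒟.cell_spec g)
  rw [Metric.mem_closedBall, ← 𝒟.dist_mul_left (𝒟.cell g : G)] at this
  simpa using this

lemma dist_dil_iterate {s : ℝ} (hs : 0 < s) (n : ℕ) (g h : G) :
    dist ((𝒟.dil s)^[n] g) ((𝒟.dil s)^[n] h) = s ^ n * dist g h := by
  induction n with
  | zero => simp
  | succ n ih =>
    rw [Function.iterate_succ_apply', Function.iterate_succ_apply', 𝒟.dist_dil s hs, ih, pow_succ']
    ring

end DilationDatum

/-! ### Ancestors in the lattice and equivariance of the iterated substitution -/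

namespace SubstitutionDatum

variable {G : Type*} [Group G] [MetricSpace G] {𝒟 : DilationDatum G} {A : Type*}
  (𝒮 : SubstitutionDatum 𝒟 A)

/-- The dilation of the lattice as a homomorphism. -/
def dilHom : 𝒟.lattice →* 𝒟.lattice where
  toFun := 𝒮.dilLattice
  map_one' := Subtype.ext (by simp [dilLattice])
  map_mul' a b := Subtype.ext (by simp [dilLattice])

lemma coe_dilHom_iterate (n : ℕ) (γ : 𝒟.lattice) :
    ((𝒮.dilHom^[n] γ : 𝒟.lattice) : G) = (𝒟.dil 𝒮.stretch)^[n] (γ : G) := by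
  induction n with
  | zero => rfl
  | succ n ih =>
    rw [Function.iterate_succ_apply', Function.iterate_succ_apply', ← ih]
    rfl

lemma parent_dilHom_mul (γ g : 𝒟.lattice) :
    𝒮.parent (𝒮.dilHom γ * g) = γ * 𝒮.parent g := by
  have : (𝒟.dil 𝒮.stretch).symm ((𝒮.dilHom γ * g : 𝒟.lattice) : G)
      = γ * (𝒟.dil 𝒮.stretch).symm (g : G) := by
    simp [dilHom, dilLattice]
  rw [parent, this, 𝒟.cell_coe_mul, parent]

lemma offset_dilHom_mul (γ g : 𝒟.lattice) :
    𝒮.offset (𝒮.dilHom γ * g) = 𝒮.offset g := by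
  apply Subtype.ext
  change (𝒮.dilHom (𝒮.parent (𝒮.dilHom γ * g)))⁻¹ * (𝒮.dilHom γ * g)
    = (𝒮.dilHom (𝒮.parent g))⁻¹ * g
  rw [parent_dilHom_mul, map_mul]
  group

lemma parent_iterate_mul (n : ℕ) (γ g : 𝒟.lattice) :
    𝒮.parent^[n] (𝒮.dilHom^[n] γ * g) = γ * 𝒮.parent^[n] g := by
  induction n generalizing g with
  | zero => rfl
  | succ n ih =>
    rw [Function.iterate_succ_apply' 𝒮.dilHom, Function.iterate_succ_apply, parent_dilHom_mul, ih,
      Function.iterate_succ_apply]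

/-- The `n`-th iterate of the substitution at `g` is determined by the letter at the `n`-th
ancestor of `g`, in an equivariant way. -/
lemma substPatch_iterate_congr {P Q : Patch 𝒟.lattice A} (n : ℕ) (γ g : 𝒟.lattice)
    (h : P (γ * 𝒮.parent^[n] g) = Q (𝒮.parent^[n] g)) :
    𝒮.substPatch^[n] P (𝒮.dilHom^[n] γ * g) = 𝒮.substPatch^[n] Q g := by
  induction n generalizing g with
  | zero => exact h
  | succ n ih =>
    rw [Function.iterate_succ_apply' 𝒮.substPatch, Function.iterate_succ_apply' 𝒮.substPatch,
      Function.iterate_succ_apply' 𝒮.dilHom, substPatch, substPatch, parent_dilHom_mul,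
      offset_dilHom_mul, ih _ h]

lemma substPatch_iterate_eq_none_iff {P : Patch 𝒟.lattice A} (n : ℕ) (g : 𝒟.lattice) :
    𝒮.substPatch^[n] P g = none ↔ P (𝒮.parent^[n] g) = none := by
  induction n generalizing g with
  | zero => rfl
  | succ n ih =>
    rw [Function.iterate_succ_apply', Function.iterate_succ_apply, ← ih]
    exact Option.map_eq_none_iff

lemma substPatch_iterate_configPatch (n : ℕ) (ω : 𝒟.lattice → A) :
    𝒮.substPatch^[n] (configPatch ω) = configPatch (𝒮.substConfig^[n] ω) := by
  induction n with
  | zero => rfl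
  | succ n ih => rw [Function.iterate_succ_apply', ih, Function.iterate_succ_apply']; rfl

/-- An occurrence at `γ` becomes an occurrence at `D^n(γ)`, because the letters of `S^n` depend only
on the letter at the `n`-th ancestor. -/
lemma isSubpatch_substPatch_iterate {P Q : Patch 𝒟.lattice A} (n : ℕ) (h : IsSubpatch P Q) :
    IsSubpatch (𝒮.substPatch^[n] P) (𝒮.substPatch^[n] Q) := by
  rw [isSubpatch_iff] at *
  obtain ⟨γ, hγ⟩ := h
  refine ⟨𝒮.dilHom^[n] γ, fun η a ha => ?_⟩
  rw [← ha]
  apply substPatch_iterate_congr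
  have : P (𝒮.parent^[n] η) ≠ none := by
    rw [ne_eq, ← substPatch_iterate_eq_none_iff, ha]
    simp
  obtain ⟨b, hb⟩ := Option.ne_none_iff_exists'.1 this
  rw [hγ _ _ hb, hb]

/-- Undoing one dilation and then choosing the tile is one application of `parent`. This turns the
geometric sets `V(n, M)`, and with them stretch factors and testing tuples, into statements about
ancestors. -/
lemma mem_inflate_iff (n : ℕ) (M : Set 𝒟.lattice) (g : 𝒟.lattice) :
    (g : G) ∈ 𝒟.inflate 𝒮.stretch n M ↔ 𝒮.parent^[n] g ∈ M := by
  induction n generalizing g with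
  | zero =>
    constructor
    · rintro ⟨_, ⟨γ, hγ, rfl⟩, v, hv, h⟩
      have : 𝒟.cell (g : G) = γ := 𝒟.cell_eq (by rw [← h]; simpa using hv)
      rw [𝒟.cell_coe] at this
      rwa [← this] at hγ
    · intro h
      exact ⟨g, ⟨g, h, rfl⟩, 1, interior_subset 𝒟.one_mem_interior, by simp⟩
  | succ n ih =>
    rw [Function.iterate_succ_apply, ← ih]
    constructor
    · rintro ⟨_, ⟨γ, ⟨hγ, hγ'⟩, v, hv, rfl⟩, h⟩
      have : 𝒮.parent g = ⟨γ, hγ'⟩ := 𝒟.cell_eq (by rw [← h]; simpa using hv)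
      rwa [this]
    · intro h
      refine ⟨(𝒟.dil 𝒮.stretch).symm (g : G), ⟨𝒮.parent g, ⟨h, (𝒮.parent g).2⟩, _,
        𝒟.cell_spec ((𝒟.dil 𝒮.stretch).symm (g : G)), ?_⟩, by simp⟩
      simp [parent]

lemma smul_subset_smul_inflate_iff (n : ℕ) (M K : Set 𝒟.lattice) (x γ : 𝒟.lattice) :
    (x : G) • ((↑) '' K : Set G) ⊆
        ((𝒟.dil 𝒮.stretch)^[n] (γ : G)) • 𝒟.inflate 𝒮.stretch n M ↔
      ∀ η ∈ K, γ⁻¹ * 𝒮.parent^[n] (x * η) ∈ M := by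
  have key : ∀ η : 𝒟.lattice, (x : G) * η ∈
      ((𝒟.dil 𝒮.stretch)^[n] (γ : G)) • 𝒟.inflate 𝒮.stretch n M ↔
        γ⁻¹ * 𝒮.parent^[n] (x * η) ∈ M := by
    intro η
    rw [mem_smul_set_iff_inv_smul_mem, ← coe_dilHom_iterate, smul_eq_mul]
    have := 𝒮.mem_inflate_iff n M ((𝒮.dilHom^[n] γ)⁻¹ * (x * η))
    rw [← iterate_map_inv, parent_iterate_mul, iterate_map_inv] at this
    simpa using this
  constructor
  · intro h η hη
    exact (key η).1 (h ⟨η, ⟨η, hη, rfl⟩, rfl⟩)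
  · rintro h _ ⟨_, ⟨η, hη, rfl⟩, rfl⟩
    exact (key η).2 (h η hη)

/-- If all translates of `F` are contained in `n`-fold inflations of translates of `T`, then every
patch of `S^n ω` on `F` occurs in the `n`-fold substitution of a patch of `ω` on `T`. -/
lemma exists_isSubpatch_of_inflate {n : ℕ} {F T : Finset 𝒟.lattice}
    (h : ∀ x : 𝒟.lattice, ∃ γ : 𝒟.lattice, ∀ η ∈ F, γ⁻¹ * 𝒮.parent^[n] (x * η) ∈ T)
    {ω : 𝒟.lattice → A} {P : F → A} (hP : P ∈ dictionaryOn (𝒮.substConfig^[n] ω) F) :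
    ∃ Q ∈ dictionaryOn ω T, IsSubpatch (finPatch P) (𝒮.substPatch^[n] (finPatch Q)) := by
  obtain ⟨x, hx⟩ := mem_dictionaryOn.1 hP
  obtain ⟨γ, hγ⟩ := h x
  refine ⟨_, restrict_mem_dictionaryOn T ω γ, isSubpatch_finPatch_iff.2
    ⟨𝒮.dilHom^[n] γ⁻¹ * x, fun η => ?_⟩⟩
  have h1 : 𝒮.substPatch^[n] (configPatch ω) (x * η) = some (P η) := by
    rw [substPatch_iterate_configPatch]
    exact congrArg some (hx η)
  rw [← h1, mul_assoc]
  apply substPatch_iterate_congr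
  exact finPatch_eq_some.2 ⟨hγ η η.2, by simp⟩

/-- Tiles have bounded size, so every child of `γ` lies within a fixed distance of `D(γ)`, and
lattice balls are finite. -/
lemma finite_preimage_parent (s : Set 𝒟.lattice) (hs : s.Finite) : (𝒮.parent ⁻¹' s).Finite := by
  obtain ⟨c, hc⟩ := 𝒟.exists_dist_cell_le
  have h0 : 0 < 𝒮.stretch := one_pos.trans 𝒮.isStretchFactor.one_lt
  refine (hs.biUnion fun γ _ => 𝒟.finite_ball (𝒮.dilHom γ) (𝒮.stretch * c + 1)).subset ?_
  intro g hg
  refine mem_biUnion hg (Metric.mem_ball.2 (lt_of_le_of_lt ?_ (lt_add_one _)))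
  have := 𝒟.dist_dil _ h0 ((𝒟.dil 𝒮.stretch).symm (g : G)) (𝒮.parent g : G)
  rw [MulEquiv.apply_symm_apply] at this
  calc dist g (𝒮.dilHom (𝒮.parent g))
      = 𝒮.stretch * dist ((𝒟.dil 𝒮.stretch).symm (g : G)) (𝒮.parent g : G) := this
    _ ≤ _ := by gcongr; exact hc _

lemma finite_preimage_parent_iterate (n : ℕ) (s : Set 𝒟.lattice) (hs : s.Finite) :
    (𝒮.parent^[n] ⁻¹' s).Finite := by
  induction n generalizing s with
  | zero => exact hs
  | succ n ih =>
    rw [Function.iterate_succ, preimage_comp]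
    exact 𝒮.finite_preimage_parent _ (ih s hs)

/-! ### Legal patches -/

lemma legal_of_isSubpatch {P Q : Patch 𝒟.lattice A} (hfin : P.supp.Finite) (h : IsSubpatch P Q)
    (hQ : Q ∈ 𝒮.legal) : P ∈ 𝒮.legal := by
  obtain ⟨-, n, hn, a, ha⟩ := hQ
  exact ⟨hfin, n, hn, a, h.trans ha⟩

/-- Read contrapositively, an illegal patch can only descend from an illegal one; this is what
traces illegal patches back through the substitution graph. -/
lemma legal_of_isSubpatch_substPatch {P Q : Patch 𝒟.lattice A} (m : ℕ) (hfin : P.supp.Finite)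
    (h : IsSubpatch P (𝒮.substPatch^[m] Q)) (hQ : Q ∈ 𝒮.legal) : P ∈ 𝒮.legal := by
  obtain ⟨-, n, hn, a, ha⟩ := hQ
  refine ⟨hfin, m + n, by omega, a, h.trans ?_⟩
  rw [Function.iterate_add_apply]
  exact 𝒮.isSubpatch_substPatch_iterate m ha

variable {𝒮}

/-- A legal patch occurs in every sufficiently high iterate of the substitution (along a fixed
arithmetic progression) on every letter. -/
lemma IsPrimitive.exists_isSubpatch (hprim : 𝒮.IsPrimitive) {P : Patch 𝒟.lattice A}
    (hP : P ∈ 𝒮.legal) (k : ℕ) : ∃ j, k ≤ j ∧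
      ∀ b, IsSubpatch P (𝒮.substPatch^[j] (letterPatch b)) := by
  obtain ⟨L, hL, hab⟩ := hprim
  have step : ∀ n, (∃ a, IsSubpatch P (𝒮.substPatch^[n] (letterPatch a))) →
      ∀ b, IsSubpatch P (𝒮.substPatch^[n + L] (letterPatch b)) := by
    rintro n ⟨a, ha⟩ b
    rw [Function.iterate_add_apply]
    exact ha.trans (𝒮.isSubpatch_substPatch_iterate n (hab a b))
  obtain ⟨-, n, -, a, ha⟩ := hP
  induction k with
  | zero => exact ⟨n + L, by omega, step n ⟨a, ha⟩⟩
  | succ k ih =>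
    obtain ⟨j, hj, h⟩ := ih
    exact ⟨j + L, by omega, step j ⟨a, h a⟩⟩

/-- One exponent `j` works for all letters, so for `n = j + m` it can be applied to whatever letter
`S^m(ω)` has at the identity. -/
lemma IsPrimitive.eventually_mem_dictionary (hprim : 𝒮.IsPrimitive) {P : Patch 𝒟.lattice A}
    (hP : P ∈ 𝒮.legal) (ω : 𝒟.lattice → A) :
    ∀ᶠ n in atTop, P ∈ dictionary (𝒮.substConfig^[n] ω) := by
  obtain ⟨j, -, hj⟩ := hprim.exists_isSubpatch hP 0
  filter_upwards [eventually_ge_atTop j] with n hn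
  obtain ⟨m, rfl⟩ := Nat.exists_eq_add_of_le hn
  refine ⟨hP.1, ?_⟩
  rw [← substPatch_iterate_configPatch, Function.iterate_add_apply, substPatch_iterate_configPatch]
  exact (hj _).trans (𝒮.isSubpatch_substPatch_iterate j
    (isSubpatch_letterPatch_iff.2 ⟨1, rfl⟩))

/-- Minimality of the subshift: every legal patch occurs in each of its elements. -/
lemma IsPrimitive.mem_dictionary (hprim : 𝒮.IsPrimitive) {P : Patch 𝒟.lattice A}
    (hP : P ∈ 𝒮.legal) {ω : 𝒟.lattice → A} (hω : ω ∈ 𝒮.subshift) : P ∈ dictionary ω := by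
  classical
  refine ⟨hP.1, ?_⟩
  obtain ⟨k, -, hk⟩ := hprim.exists_isSubpatch hP 0
  set M : Finset 𝒟.lattice := (𝒮.finite_preimage_parent_iterate k {1} (finite_singleton 1)).toFinset
    with hM
  have memM : ∀ g, g ∈ M ↔ 𝒮.parent^[k] g = 1 := fun g => by simp [hM]
  -- `M` is the shape of a `k`-fold substituted letter. If `x` lies in a supertile `D^k(y) M`, then
  -- that whole supertile lies in `x M⁻¹ M`. So wherever the patch of `ω` on `F` occurs in some
  -- `S^(k+i)(a)`, it contains a complete `S^k(b)`, and with it `P`. Adding `1` gives direct access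
  -- to the letter at `x` itself.
  set F : Finset 𝒟.lattice := M⁻¹ * M ∪ {1} with hF
  have hleg : finPatch (fun η : F => ω (1 * η)) ∈ 𝒮.legal := hω (restrict_mem_dictionaryOn F ω 1)
  obtain ⟨j, hkj, hj⟩ := hprim.exists_isSubpatch hleg k
  obtain ⟨x, hx⟩ := isSubpatch_finPatch_iff.1 (hj (ω 1))
  obtain ⟨i, rfl⟩ := Nat.exists_eq_add_of_le hkj
  set y := 𝒮.parent^[k] x with hy
  have hxM : 𝒮.dilHom^[k] y⁻¹ * x ∈ M := by
    rw [memM, parent_iterate_mul, ← hy, inv_mul_cancel]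
  obtain ⟨b, hb⟩ : ∃ b, 𝒮.substPatch^[i] (letterPatch (ω 1)) y = some b := by
    rw [← Option.ne_none_iff_exists', ne_eq, ← 𝒮.substPatch_iterate_eq_none_iff k (g := x),
      ← Function.iterate_add_apply]
    have := hx ⟨1, by simp [hF]⟩
    simp only [mul_one] at this
    simp [this]
  refine (hk b).trans (isSubpatch_iff.2 ⟨x⁻¹ * 𝒮.dilHom^[k] y, fun η a ha => ?_⟩)
  have hη : 𝒮.parent^[k] η = 1 := by
    have h0 : 𝒮.substPatch^[k] (letterPatch b) η ≠ none := by simp [ha]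
    rw [ne_eq, substPatch_iterate_eq_none_iff] at h0
    obtain ⟨c, hc⟩ := Option.ne_none_iff_exists'.1 h0
    exact (letterPatch_eq_some.1 hc).1
  have hmem : x⁻¹ * 𝒮.dilHom^[k] y * η ∈ F := by
    refine Finset.mem_union_left _ (Finset.mul_mem_mul ?_ ((memM η).2 hη))
    rw [Finset.mem_inv']
    simpa using hxM
  have h2 := hx ⟨_, hmem⟩
  simp only [one_mul] at h2
  rw [configPatch, ← h2, ← ha, Function.iterate_add_apply]
  have : x * (x⁻¹ * 𝒮.dilHom^[k] y * η) = 𝒮.dilHom^[k] y * η := by group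
  rw [this]
  apply substPatch_iterate_congr
  rw [hη, mul_one, hb]
  exact (letterPatch_eq_some.2 ⟨rfl, rfl⟩).symm

lemma IsPrimitive.mem_dictionaryOn_iff (hprim : 𝒮.IsPrimitive) {ω : 𝒟.lattice → A}
    (hω : ω ∈ 𝒮.subshift) {F : Finset 𝒟.lattice} {P : F → A} :
    P ∈ dictionaryOn ω F ↔ finPatch P ∈ 𝒮.legal :=
  ⟨fun h => hω h, fun h => hprim.mem_dictionary h hω⟩

variable (𝒮)

/-- The supports of the iterated substitutions of a letter contain arbitrarily large balls. -/
lemma exists_forall_parent_iterate_eq_one (r : ℝ) : ∃ n, 1 ≤ n ∧ ∃ x : 𝒟.lattice,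
    ∀ η ∈ Metric.ball (1 : 𝒟.lattice) r, 𝒮.parent^[n] (x * η) = 1 := by
  obtain ⟨C, hC, m, z, h⟩ := 𝒮.isStretchFactor.large
  have h1 := 𝒮.isStretchFactor.one_lt
  obtain ⟨n, hn⟩ := pow_unbounded_of_one_lt (r / C) h1
  have h2 : r ≤ 𝒮.stretch ^ (n + 1) * C := by
    rw [div_lt_iff₀ hC] at hn
    refine hn.le.trans ?_
    gcongr
    · exact h1.le
    · omega
  -- The exponent is `n + 1` because the stretch factor condition speaks only of exponents at least
  -- `1`; the ball of radius `C` about `z` is dilated to radius at least `r`.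
  refine ⟨m + (n + 1), by omega, 𝒮.dilHom^[n + 1] z, fun η hη => ?_⟩
  have := (𝒮.mem_inflate_iff (m + (n + 1)) {1} (𝒮.dilHom^[n + 1] z * η)).1
  refine this (h (n + 1) (by omega) ?_)
  obtain ⟨g, hg⟩ := (𝒟.dil 𝒮.stretch).surjective.iterate (n + 1)
    ((𝒮.dilHom^[n + 1] z * η : 𝒟.lattice) : G)
  refine ⟨g, ?_, hg⟩
  have h3 := 𝒟.dist_dil_iterate (one_pos.trans h1) (n + 1) g (z : G)
  have h4 : dist ((𝒮.dilHom^[n + 1] z * η : 𝒟.lattice) : G) (𝒮.dilHom^[n + 1] z : 𝒟.lattice)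
      = dist η 1 := by
    have := 𝒟.dist_mul_left (𝒮.dilHom^[n + 1] z : 𝒟.lattice) η 1
    rwa [mul_one] at this
  rw [hg, ← coe_dilHom_iterate, h4] at h3
  have h5 : dist η 1 < 𝒮.stretch ^ (n + 1) * C := (Metric.mem_ball.1 hη).trans_le h2
  rw [h3] at h5
  exact Metric.mem_ball.2 (lt_of_mul_lt_mul_left h5 (by positivity))

lemma subshift_nonempty [Finite A] [Nonempty A] : 𝒮.subshift.Nonempty := by
  classical
  let : TopologicalSpace A := ⊥
  have : DiscreteTopology A := ⟨rfl⟩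
  have a : A := Classical.arbitrary A
  choose n hn x hx using fun k : ℕ => 𝒮.exists_forall_parent_iterate_eq_one k
  -- Recentred at `x k`, the ball of radius `k` lies inside the image of the single letter at `1`.
  -- All patches seen there are legal, and a cluster point inherits this on every finite set.
  let ρ : ℕ → 𝒟.lattice → A := fun k η => 𝒮.substConfig^[n k] (fun _ => a) (x k * η)
  obtain ⟨ω, -, hω⟩ := isCompact_univ.exists_mapClusterPt (f := atTop) (u := ρ) (by simp)
  refine ⟨ω, dictionary_subset_of_forall_finPatch
    (fun P Q hfin h hQ => 𝒮.legal_of_isSubpatch hfin h hQ) fun K => ?_⟩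
  have hopen : {σ : 𝒟.lattice → A | ∀ η ∈ K, σ η = ω η} ∈ 𝓝 ω := by
    have : {σ : 𝒟.lattice → A | ∀ η ∈ K, σ η = ω η} = (K : Set 𝒟.lattice).pi fun η => {ω η} := by
      ext; simp [Set.mem_pi]
    rw [this]
    exact set_pi_mem_nhds K.finite_toSet fun η _ => mem_nhds_discrete.2 rfl
  obtain ⟨r, hr⟩ : ∃ r : ℕ, ∀ η ∈ K, dist η 1 < r := by
    obtain ⟨r, hr⟩ := exists_nat_gt (∑ η ∈ K, dist η 1)
    exact ⟨r, fun η hη => (Finset.single_le_sum (f := fun η => dist η 1) (fun _ _ => dist_nonneg) hη).trans_lt hr⟩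
  obtain ⟨k, hk, hrk⟩ := ((hω.frequently hopen).and_eventually (eventually_ge_atTop r)).exists
  refine ⟨finPatch_supp_finite _, n k, hn k, a, isSubpatch_finPatch_iff.2 ⟨x k, fun η => ?_⟩⟩
  have h1 : 𝒮.parent^[n k] (x k * η) = 1 :=
    hx k η (Metric.mem_ball.2 ((hr η η.2).trans_le (by exact_mod_cast hrk)))
  have h2 : ρ k η = ω η := hk η η.2
  rw [← h2]
  have h3 := congrFun (𝒮.substPatch_iterate_configPatch (n k) fun _ => a) (x k * η)
  change _ = some (ρ k η) at h3
  rw [← h3]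
  have := 𝒮.substPatch_iterate_congr (P := letterPatch a) (Q := configPatch fun _ => a) (n k) 1
    (x k * η) (by rw [h1, mul_one]; exact letterPatch_eq_some.2 ⟨rfl, rfl⟩)
  rwa [show 𝒮.dilHom^[n k] 1 = 1 from iterate_map_one _ _, one_mul] at this

end SubstitutionDatum

/-! ### Følner sets -/

/-- A form of amenability: for all finite `B` there are finite sets `F₁ ⊆ F ⊆ F₃` of almost the same
size such that `F` contains `F₁ B` and `F₃` contains `F B⁻¹`. -/
def HasFolnerSets (Γ : Type*) [Group Γ] : Prop :=
  ∀ (B : Finset Γ) (δ : ℝ), 0 < δ → ∃ F₁ F F₃ : Finset Γ, F₁.Nonempty ∧ F₁ ⊆ F ∧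
    (∀ γ ∈ F₁, ∀ η ∈ B, γ * η ∈ F) ∧ (∀ γ, ∀ η ∈ B, γ * η ∈ F → γ ∈ F₃) ∧
    F₁ ⊆ F₃ ∧ (F₃.card : ℝ) ≤ (1 + δ) * F₁.card

/-- A discrete group with a left-invariant metric whose balls have at most geometric growth along
the radii `s ^ n` has Følner sets. -/
lemma hasFolnerSets_of_growth {Γ : Type*} [Group Γ] [MetricSpace Γ]
    (hdist : ∀ g h k : Γ, dist (g * h) (g * k) = dist h k)
    (hfin : ∀ r, (Metric.ball (1 : Γ) r).Finite) {s : ℝ} (hs : 1 < s) (C K : ℕ)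
    (hgrow : ∀ n : ℕ, (hfin (s ^ n)).toFinset.card ≤ C * K ^ n) : HasFolnerSets Γ := by
  intro B δ hδ
  obtain ⟨b, hb0, hb⟩ : ∃ b : ℝ, 0 < b ∧ ∀ η ∈ B, dist η 1 < b :=
    ⟨∑ η ∈ B, dist η 1 + 1, by positivity, fun η hη =>
      (Finset.single_le_sum (f := fun η => dist η 1) (fun _ _ => dist_nonneg) hη).trans_lt (lt_add_one _)⟩
  let N : ℝ → ℕ := fun r => (hfin r).toFinset.card
  have hmono : ∀ {r r'}, r ≤ r' → (hfin r).toFinset ⊆ (hfin r').toFinset := fun h => by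
    simpa using Metric.ball_subset_ball h
  have hNmono : ∀ {r r'}, r ≤ r' → N r ≤ N r' := fun h => Finset.card_le_card (hmono h)
  have hNpos : ∀ {r}, 0 < r → 0 < N r := fun h => Finset.card_pos.2 ⟨1, by simpa using h⟩
  -- If one enlargement by `2 b` is cheap, the balls of radii `r`, `r + b`, `r + 2 b` serve.
  -- Otherwise each enlargement gains a factor `1 + δ`, which contradicts the growth bound.
  by_cases hex : ∃ r : ℝ, 0 < r ∧ (N (r + 2 * b) : ℝ) ≤ (1 + δ) * N r
  · obtain ⟨r, hr, h⟩ := hex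
    have hd : ∀ γ η : Γ, dist (γ * η) γ = dist η 1 := fun γ η => by
      simpa using hdist γ η 1
    refine ⟨(hfin r).toFinset, (hfin (r + b)).toFinset, (hfin (r + 2 * b)).toFinset,
      Finset.card_pos.1 (hNpos hr), hmono (by linarith), ?_, ?_, hmono (by linarith), h⟩
    · intro γ hγ η hη
      simp only [Finite.mem_toFinset, Metric.mem_ball] at hγ ⊢
      linarith [dist_triangle (γ * η) γ 1, hd γ η, hb η hη]
    · intro γ η hη hγ
      simp only [Finite.mem_toFinset, Metric.mem_ball] at hγ ⊢
      linarith [dist_triangle_left γ 1 (γ * η), hd γ η, hb η hη]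
  · exfalso
    push Not at hex
    have h1 : ∀ (r : ℝ) (j : ℕ), 0 < r → (1 + δ) ^ j * N r ≤ N (r + 2 * b * j) := by
      intro r j hr
      induction j with
      | zero => simp
      | succ j ih =>
        have := hex (r + 2 * b * j) (by positivity)
        calc (1 + δ) ^ (j + 1) * N r = (1 + δ) * ((1 + δ) ^ j * N r) := by ring
          _ ≤ (1 + δ) * N (r + 2 * b * j) := by gcongr
          _ ≤ N (r + 2 * b * j + 2 * b) := this.le
          _ = _ := by push_cast; ring_nf
    -- A gain of `2 K` takes `j` enlargements, and beyond `s ^ n₀` there is room for them between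
    -- consecutive radii. This gives at least `(2 K) ^ k` points at radius `s ^ (n₀ + k)`, too many
    -- once `2 ^ k > C K ^ n₀`.
    obtain ⟨j, hj⟩ := pow_unbounded_of_one_lt (2 * K : ℝ) (show 1 < 1 + δ by linarith)
    obtain ⟨n₀, hn₀⟩ := pow_unbounded_of_one_lt (2 * b * j / (s - 1)) hs
    rw [div_lt_iff₀ (by linarith)] at hn₀
    have h2 : ∀ k : ℕ, (2 * K : ℝ) ^ k ≤ N (s ^ (n₀ + k)) := by
      intro k
      induction k with
      | zero => simpa using Nat.one_le_iff_ne_zero.2 (hNpos (show 0 < s ^ n₀ by positivity)).ne'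
      | succ k ih =>
        have hle : s ^ (n₀ + k) + 2 * b * j ≤ s ^ (n₀ + (k + 1)) := by
          have : s ^ n₀ ≤ s ^ (n₀ + k) := pow_le_pow_right₀ hs.le (by omega)
          have h3 : s ^ n₀ * (s - 1) ≤ s ^ (n₀ + k) * (s - 1) := by
            gcongr
          rw [← add_assoc, pow_succ]
          linarith
        calc (2 * K : ℝ) ^ (k + 1) = 2 * K * (2 * K) ^ k := by ring
          _ ≤ (1 + δ) ^ j * N (s ^ (n₀ + k)) := by gcongr
          _ ≤ N (s ^ (n₀ + k) + 2 * b * j) := h1 _ _ (by positivity)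
          _ ≤ _ := by exact_mod_cast hNmono hle
    have hK : 0 < K := by
      by_contra h0
      have h0 : K = 0 := by omega
      have := hgrow 1
      rw [h0] at this
      have h3 : 0 < N (s ^ 1) := hNpos (by positivity)
      simp only [pow_one, mul_zero, nonpos_iff_eq_zero] at this h3
      exact h3.ne' this
    obtain ⟨k, hk⟩ := pow_unbounded_of_one_lt (C * K ^ n₀ : ℝ) one_lt_two
    have h4 : (N (s ^ (n₀ + k)) : ℝ) ≤ C * K ^ (n₀ + k) := by exact_mod_cast hgrow (n₀ + k)
    have h5 := (h2 k).trans h4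
    rw [mul_pow, pow_add, ← mul_assoc] at h5
    have : (0 : ℝ) < (K : ℝ) ^ k := by positivity
    exact absurd (le_of_mul_le_mul_right h5 this) (not_le.2 hk)

/-- A cover of the ball of radius `s ^ n` by unit balls dilates to a cover by balls of radius `s`,
each covered by a fixed number of unit balls. Hence covering numbers grow geometrically. A unit ball
holds at most as many lattice points as the ball of radius `2` about the identity, since one of its
points can be translated there. -/
lemma DilationDatum.hasFolnerSets {G : Type*} [Group G] [MetricSpace G] (𝒟 : DilationDatum G)
    {s : ℝ} (hs : 1 < s) : HasFolnerSets 𝒟.lattice := by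
  classical
  have hfin := 𝒟.finite_ball
  have := 𝒟.proper
  have hs0 : 0 < s := one_pos.trans hs
  obtain ⟨t, -, htfin, ht⟩ := (isCompact_closedBall (1 : G) s).finite_cover_balls one_pos
  let t' := htfin.toFinset
  have hcov : ∀ n : ℕ, ∃ u : Finset G, u.card ≤ t'.card ^ n ∧
      ∀ g, dist g 1 < s ^ n → ∃ x ∈ u, dist g x < 1 := by
    intro n
    induction n with
    | zero => exact ⟨{1}, by simp, fun g hg => ⟨1, by simp, by simpa using hg⟩⟩
    | succ n ih =>
      obtain ⟨u, hu, h⟩ := ih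
      refine ⟨(u ×ˢ t').image fun p => 𝒟.dil s p.1 * p.2, ?_, fun g hg => ?_⟩
      · refine Finset.card_image_le.trans ?_
        rw [Finset.card_product, pow_succ]
        gcongr
      · obtain ⟨g, rfl⟩ := (𝒟.dil s).surjective g
        have h1 := 𝒟.dist_dil s hs0 g 1
        rw [map_one] at h1
        obtain ⟨x, hx, hgx⟩ := h g (by
          rw [h1, pow_succ'] at hg
          exact lt_of_mul_lt_mul_left hg hs0.le)
        have h2 : (𝒟.dil s x)⁻¹ * 𝒟.dil s g ∈ Metric.closedBall (1 : G) s := by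
          rw [Metric.mem_closedBall, ← 𝒟.dist_mul_left (𝒟.dil s x), mul_inv_cancel_left, mul_one,
            𝒟.dist_dil s hs0]
          nlinarith
        obtain ⟨y, hy, hgy⟩ := mem_iUnion₂.1 (ht h2)
        refine ⟨𝒟.dil s x * y, Finset.mem_image.2 ⟨(x, y), by simpa [t'] using ⟨hx, hy⟩, rfl⟩, ?_⟩
        rw [Metric.mem_ball, ← 𝒟.dist_mul_left (𝒟.dil s x), mul_inv_cancel_left] at hgy
        exact hgy
  have hdist : ∀ g h k : 𝒟.lattice, dist (g * h) (g * k) = dist h k :=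
    fun g h k => 𝒟.dist_mul_left g h k
  refine hasFolnerSets_of_growth hdist (hfin 1) hs (hfin 1 2).toFinset.card t'.card fun n => ?_
  obtain ⟨u, hu, h⟩ := hcov n
  have hsub : (hfin 1 (s ^ n)).toFinset ⊆
      u.biUnion fun x =>
        (hfin 1 (s ^ n)).toFinset.filter fun γ : 𝒟.lattice => dist (γ : G) x < 1 := by
    intro γ hγ
    obtain ⟨x, hx, hγx⟩ := h γ (Metric.mem_ball.1 ((hfin 1 (s ^ n)).mem_toFinset.1 hγ))
    exact Finset.mem_biUnion.2 ⟨x, hx, Finset.mem_filter.2 ⟨hγ, hγx⟩⟩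
  refine (Finset.card_le_card hsub).trans
    ((Finset.card_biUnion_le_card_mul _ _ (hfin 1 2).toFinset.card ?_).trans ?_)
  · intro x _
    rcases Finset.eq_empty_or_nonempty
      ((hfin 1 (s ^ n)).toFinset.filter fun γ : 𝒟.lattice => dist (γ : G) x < 1) with he | ⟨γ₀, hγ₀⟩
    · simp [he]
    · refine Finset.card_le_card_of_injOn (fun γ : 𝒟.lattice => γ₀⁻¹ * γ) (fun γ hγ => ?_)
        (fun _ _ _ _ h => mul_left_cancel h)
      have h1 := (Finset.mem_filter.1 hγ₀).2
      have h2 := (Finset.mem_filter.1 hγ).2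
      have h3 : dist (γ₀⁻¹ * γ) 1 = dist (γ : G) γ₀ := by
        rw [← hdist γ₀, mul_inv_cancel_left, mul_one]
        rfl
      have h4 := dist_triangle_right (γ : G) γ₀ x
      simp only [Finite.coe_toFinset, Metric.mem_ball]
      linarith
  · rw [mul_comm]
    gcongr

/-! ### Spectra of self-adjoint operators and lower bounds -/

section SelfAdjoint

variable {E : Type*} [NormedAddCommGroup E] [InnerProductSpace ℂ E] [CompleteSpace E]

lemma isSelfAdjoint_sub_real {T : E →L[ℂ] E} (hT : IsSelfAdjoint T) (x : ℝ) :
    IsSelfAdjoint (T - algebraMap ℂ (E →L[ℂ] E) x) := by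
  refine hT.sub (IsSelfAdjoint.algebraMap _ ?_)
  simp [isSelfAdjoint_iff]

/-- For self-adjoint `T` one has `⟨T² φ, φ⟩ = ‖T φ‖²`, so `T²` is coercive and thus invertible. -/
lemma isUnit_of_forall_le_norm {T : E →L[ℂ] E} (hT : IsSelfAdjoint T) {c : ℝ} (hc : 0 < c)
    (h : ∀ φ, c * ‖φ‖ ≤ ‖T φ‖) : IsUnit T := by
  have h2 : IsUnit (T ^ 2) := by
    refine ContinuousLinearMap.isUnit_of_forall_le_norm_inner_map (T ^ 2)
      (c := ⟨c ^ 2, by positivity⟩) (by exact_mod_cast (by positivity : 0 < c ^ 2)) fun φ => ?_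
    have h3 : inner ℂ ((T ^ 2) φ) φ = inner ℂ (T φ) (T φ) := by
      rw [pow_two]
      exact hT.isSymmetric (T φ) φ
    rw [h3, inner_self_eq_norm_sq_to_K]
    simp only [norm_pow, RCLike.norm_ofReal, abs_norm]
    calc ‖φ‖ ^ 2 * c ^ 2 = (c * ‖φ‖) ^ 2 := by ring
      _ ≤ _ := by gcongr; exact h φ
  exact (isUnit_pow_iff two_ne_zero).1 h2

/-- The inverse of `T` is self-adjoint, so its norm equals its spectral radius, which is at most
`c⁻¹`. -/
lemma le_norm_of_forall_spectrum {T : E →L[ℂ] E} (hT : IsSelfAdjoint T) {c : ℝ} (hc : 0 < c)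
    (h : ∀ z ∈ spectrum ℂ T, c ≤ ‖z‖) (φ : E) : c * ‖φ‖ ≤ ‖T φ‖ := by
  have hu : IsUnit T := by
    rw [← spectrum.zero_notMem_iff ℂ]
    intro h0
    have := h 0 h0
    rw [norm_zero] at this
    linarith
  obtain ⟨u, rfl⟩ := hu
  have hinv : IsSelfAdjoint ((u⁻¹ : (E →L[ℂ] E)ˣ) : E →L[ℂ] E) := by
    rw [isSelfAdjoint_iff, ← Units.coe_star, star_inv]
    congr 2
    exact Units.ext hT.star_eq
  have hnorm : ‖((u⁻¹ : (E →L[ℂ] E)ˣ) : E →L[ℂ] E)‖ ≤ c⁻¹ := by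
    have h1 : spectralRadius ℂ ((u⁻¹ : (E →L[ℂ] E)ˣ) : E →L[ℂ] E) ≤ ENNReal.ofReal c⁻¹ := by
      refine iSup₂_le fun z hz => ?_
      rw [← spectrum.inv₀_mem_iff] at hz
      have h2 := h _ hz
      rw [norm_inv] at h2
      rw [← enorm_eq_nnnorm, ← ofReal_norm]
      exact ENNReal.ofReal_le_ofReal (le_inv_of_le_inv₀ hc h2)
    rw [hinv.spectralRadius_eq_nnnorm, ← enorm_eq_nnnorm, ← ofReal_norm] at h1
    exact (ENNReal.ofReal_le_ofReal_iff (by positivity)).1 h1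
  calc c * ‖φ‖ = c * ‖((u⁻¹ : (E →L[ℂ] E)ˣ) : E →L[ℂ] E) ((u : E →L[ℂ] E) φ)‖ := by
        rw [← mul_apply_eq_comp, Units.inv_mul, one_apply_eq_self]
    _ ≤ c * (c⁻¹ * ‖(u : E →L[ℂ] E) φ‖) := by
        gcongr
        exact ContinuousLinearMap.le_of_opNorm_le _ hnorm _
    _ = _ := by field_simp

end SelfAdjoint

/-! ### Square sums -/

section SquareSums

variable {Γ : Type*}

lemma ofReal_norm_sq_eq_tsum (ψ : lp (fun _ : Γ => ℂ) 2) :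
    ENNReal.ofReal (‖ψ‖ ^ 2) = ∑' γ, ENNReal.ofReal (‖ψ γ‖ ^ 2) := by
  have h2 : (0 : ℝ) < (2 : ℝ≥0∞).toReal := by norm_num
  have h := lp.norm_rpow_eq_tsum h2 ψ
  have hs := (lp.memℓp ψ).summable h2
  simp only [ENNReal.toReal_ofNat, Real.rpow_ofNat] at h hs
  rw [h, ENNReal.ofReal_tsum_of_nonneg (fun _ => by positivity) hs]

lemma norm_eq_of_apply_equiv (e : Γ ≃ Γ) {ψ φ : lp (fun _ : Γ => ℂ) 2}
    (h : ∀ γ, ψ γ = φ (e γ)) : ‖ψ‖ = ‖φ‖ := by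
  have h1 : ENNReal.ofReal (‖ψ‖ ^ 2) = ENNReal.ofReal (‖φ‖ ^ 2) := by
    rw [ofReal_norm_sq_eq_tsum, ofReal_norm_sq_eq_tsum,
      ← e.tsum_eq fun γ => ENNReal.ofReal (‖φ γ‖ ^ 2)]
    simp only [h]
  rw [ENNReal.ofReal_eq_ofReal_iff (by positivity) (by positivity)] at h1
  exact (sq_eq_sq₀ (norm_nonneg _) (norm_nonneg _)).1 h1

/-- Cauchy–Schwarz. The coefficients are bounded only where `z` does not vanish, since later they
are compared only near the support of a test function. -/
lemma norm_sum_mul_sq_le (B : Finset Γ) (a z : Γ → ℂ) {C : ℝ}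
    (h : ∀ η ∈ B, z η ≠ 0 → ‖a η‖ ≤ C) :
    ‖∑ η ∈ B, a η * z η‖ ^ 2 ≤ C ^ 2 * B.card * ∑ η ∈ B, ‖z η‖ ^ 2 := by
  calc ‖∑ η ∈ B, a η * z η‖ ^ 2 ≤ (∑ η ∈ B, ‖a η * z η‖) ^ 2 := by
        gcongr
        exact norm_sum_le _ _
    _ ≤ B.card * ∑ η ∈ B, ‖a η * z η‖ ^ 2 := sq_sum_le_card_mul_sum_sq
    _ ≤ B.card * ∑ η ∈ B, C ^ 2 * ‖z η‖ ^ 2 := by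
        gcongr with η hη
        by_cases hz : z η = 0
        · simp [hz]
        · rw [norm_mul, mul_pow]
          gcongr
          exact h η hη hz
    _ = _ := by rw [← Finset.mul_sum]; ring

open Classical in
/-- The restriction of an `ℓ²`-function to a set. -/
noncomputable def cutoff (M : Set Γ) (ψ : lp (fun _ : Γ => ℂ) 2) : lp (fun _ : Γ => ℂ) 2 :=
  ⟨fun γ => if γ ∈ M then ψ γ else 0, by
    have h2 : (0 : ℝ) < (2 : ℝ≥0∞).toReal := by norm_num
    refine memℓp_gen (Summable.of_nonneg_of_le (fun _ => by positivity) (fun γ => ?_)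
      ((lp.memℓp ψ).summable h2))
    split_ifs
    · exact le_rfl
    · rw [norm_zero, Real.zero_rpow h2.ne']
      positivity⟩

open Classical in
lemma cutoff_apply (M : Set Γ) (ψ : lp (fun _ : Γ => ℂ) 2) (γ : Γ) :
    cutoff M ψ γ = if γ ∈ M then ψ γ else 0 := rfl

variable [Group Γ]

lemma tsum_ofReal_mul_sum (B : Finset Γ) {K : ℝ} (hK : 0 ≤ K) (φ : lp (fun _ : Γ => ℂ) 2) :
    ∑' γ, ENNReal.ofReal (K * ∑ η ∈ B, ‖φ (γ * η)‖ ^ 2)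
      = ENNReal.ofReal (K * B.card * ‖φ‖ ^ 2) := by
  have h1 : ∀ γ, ENNReal.ofReal (K * ∑ η ∈ B, ‖φ (γ * η)‖ ^ 2)
      = ENNReal.ofReal K * ∑ η ∈ B, ENNReal.ofReal (‖φ (γ * η)‖ ^ 2) := fun γ => by
    rw [ENNReal.ofReal_mul hK, ENNReal.ofReal_sum_of_nonneg fun _ _ => by positivity]
  have h2 : ∀ η : Γ, ∑' γ, ENNReal.ofReal (‖φ (γ * η)‖ ^ 2) = ENNReal.ofReal (‖φ‖ ^ 2) := by
    intro η
    rw [ofReal_norm_sq_eq_tsum]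
    exact (Equiv.mulRight η).tsum_eq fun γ => ENNReal.ofReal (‖φ γ‖ ^ 2)
  simp_rw [h1]
  rw [ENNReal.tsum_mul_left, Summable.tsum_finsetSum fun _ _ => ENNReal.summable]
  simp_rw [h2]
  rw [Finset.sum_const, nsmul_eq_mul, ENNReal.ofReal_mul (by positivity), ENNReal.ofReal_mul hK,
    ENNReal.ofReal_natCast, mul_assoc]

lemma norm_sq_le_of_apply_le (B : Finset Γ) {K : ℝ} (hK : 0 ≤ K) {ψ φ : lp (fun _ : Γ => ℂ) 2}
    (h : ∀ γ, ‖ψ γ‖ ^ 2 ≤ K * ∑ η ∈ B, ‖φ (γ * η)‖ ^ 2) :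
    ‖ψ‖ ^ 2 ≤ K * B.card * ‖φ‖ ^ 2 := by
  rw [← ENNReal.ofReal_le_ofReal_iff (by positivity), ← tsum_ofReal_mul_sum B hK,
    ofReal_norm_sq_eq_tsum]
  exact ENNReal.tsum_le_tsum fun γ => ENNReal.ofReal_le_ofReal (h γ)

open Classical in
lemma tsum_ite_inv_mul_mem (M : Finset Γ) (γ : Γ) (a : ℝ≥0∞) :
    ∑' x : Γ, (if x⁻¹ * γ ∈ M then a else 0) = M.card * a := by
  have := ((Equiv.inv Γ).trans (Equiv.mulRight γ)).tsum_eq fun x => if x ∈ M then a else 0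
  simp only [Equiv.trans_apply, Equiv.inv_apply, Equiv.coe_mulRight] at this
  rw [this, tsum_eq_sum (s := M) fun x hx => if_neg hx, Finset.sum_ite_mem]
  simp

/-- Over a group with Følner sets, a lower bound for a linear operator of finite range, tested on
functions supported in translates of a large finite set, implies a global lower bound. -/
lemma HasFolnerSets.exists_lower_bound (hΓ : HasFolnerSets Γ) (B : Finset Γ) {K c : ℝ}
    (hK : 0 ≤ K) (hc : 0 < c) :
    ∃ F : Finset Γ, ∀ T : lp (fun _ : Γ => ℂ) 2 →L[ℂ] lp (fun _ : Γ => ℂ) 2,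
      (∀ ψ γ, ‖T ψ γ‖ ^ 2 ≤ K * ∑ η ∈ B, ‖ψ (γ * η)‖ ^ 2) →
      (∀ (x : Γ) (φ : lp (fun _ : Γ => ℂ) 2), (∀ γ, φ γ ≠ 0 → x⁻¹ * γ ∈ F) →
        2 * c * ‖φ‖ ≤ ‖T φ‖) →
      ∀ ψ, c * ‖ψ‖ ≤ ‖T ψ‖ := by
  classical
  -- This `δ` makes the boundary error at most `3 c² |F₁| ‖ψ‖²`, leaving `c²` of the local constant
  -- `(2 c)² = 4 c²`. The `+ 1` keeps the denominator positive.
  obtain ⟨F₁, F, F₃, hne, h1F, h1, h3, h13, hcard⟩ :=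
    hΓ B (3 * c ^ 2 / (K * B.card + 1)) (by positivity)
  refine ⟨F, fun T hT hloc ψ => ?_⟩
  set cut : Γ → lp (fun _ : Γ => ℂ) 2 := fun x => cutoff {γ | x⁻¹ * γ ∈ F} ψ with hcut
  have cut_apply : ∀ x γ, cut x γ = if x⁻¹ * γ ∈ F then ψ γ else 0 := fun x γ => by
    simp [hcut, cutoff_apply]
  have hzero : ∀ (φ : lp (fun _ : Γ => ℂ) 2) γ, (∀ η ∈ B, φ (γ * η) = 0) → T φ γ = 0 := by
    intro φ γ h
    have := hT φ γ
    rw [Finset.sum_eq_zero fun η hη => by rw [h η hη]; simp, mul_zero] at this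
    simpa using this
  -- Truncating `ψ` to `x F` leaves `T ψ` unchanged on `x F₁` and gives zero outside `x F₃`; only
  -- the layer in between needs the crude bound. Summing over all `x` counts each point `|F₁|`,
  -- `|F|` or `|F₃ \ F₁|` times.
  have hpt : ∀ x γ, ENNReal.ofReal (‖T (cut x) γ‖ ^ 2) ≤
      (if x⁻¹ * γ ∈ F₁ then ENNReal.ofReal (‖T ψ γ‖ ^ 2) else 0) +
      (if x⁻¹ * γ ∈ F₃ \ F₁ then ENNReal.ofReal (K * ∑ η ∈ B, ‖ψ (γ * η)‖ ^ 2) else 0) := by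
    intro x γ
    by_cases hγ1 : x⁻¹ * γ ∈ F₁
    · have : T (cut x - ψ) γ = 0 := hzero _ _ fun η hη => by
        rw [lp.coeFn_sub, Pi.sub_apply, cut_apply, ← mul_assoc, if_pos (h1 _ hγ1 η hη), sub_self]
      rw [map_sub, lp.coeFn_sub, Pi.sub_apply, sub_eq_zero] at this
      rw [this, if_pos hγ1]
      exact le_self_add
    by_cases hγ3 : x⁻¹ * γ ∈ F₃
    · rw [if_pos (Finset.mem_sdiff.2 ⟨hγ3, hγ1⟩)]
      refine le_add_left (ENNReal.ofReal_le_ofReal ((hT _ _).trans ?_))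
      gcongr with η hη
      rw [cut_apply]
      split_ifs
      · exact le_rfl
      · simp
    · rw [hzero (cut x) γ fun η hη => by
        rw [cut_apply, if_neg]
        intro h
        rw [← mul_assoc] at h
        exact hγ3 (h3 _ η hη h)]
      simp
  have hsum : ∑' x, ENNReal.ofReal (‖cut x‖ ^ 2) = F.card * ENNReal.ofReal (‖ψ‖ ^ 2) := by
    have : ∀ x γ, ENNReal.ofReal (‖cut x γ‖ ^ 2)
        = if x⁻¹ * γ ∈ F then ENNReal.ofReal (‖ψ γ‖ ^ 2) else 0 := fun x γ => by
      rw [cut_apply]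
      split_ifs <;> simp
    simp_rw [ofReal_norm_sq_eq_tsum, this]
    rw [ENNReal.tsum_comm]
    simp_rw [tsum_ite_inv_mul_mem]
    rw [ENNReal.tsum_mul_left]
  have hupper : ∑' x, ENNReal.ofReal (‖T (cut x)‖ ^ 2) ≤
      F₁.card * ENNReal.ofReal (‖T ψ‖ ^ 2) +
        (F₃ \ F₁).card * ENNReal.ofReal (K * B.card * ‖ψ‖ ^ 2) := by
    calc ∑' x, ENNReal.ofReal (‖T (cut x)‖ ^ 2)
        = ∑' x, ∑' γ, ENNReal.ofReal (‖T (cut x) γ‖ ^ 2) := by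
          simp_rw [ofReal_norm_sq_eq_tsum (T _)]
      _ ≤ _ := ENNReal.tsum_le_tsum fun x => ENNReal.tsum_le_tsum (hpt x)
      _ = _ := by
          rw [ENNReal.tsum_comm]
          simp_rw [ENNReal.tsum_add, tsum_ite_inv_mul_mem]
          rw [ENNReal.tsum_mul_left, ENNReal.tsum_mul_left, tsum_ofReal_mul_sum B hK,
            ← ofReal_norm_sq_eq_tsum]
  have hlower : ENNReal.ofReal ((2 * c) ^ 2) * ∑' x, ENNReal.ofReal (‖cut x‖ ^ 2) ≤
      ∑' x, ENNReal.ofReal (‖T (cut x)‖ ^ 2) := by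
    rw [← ENNReal.tsum_mul_left]
    refine ENNReal.tsum_le_tsum fun x => ?_
    rw [← ENNReal.ofReal_mul (by positivity), ← mul_pow]
    refine ENNReal.ofReal_le_ofReal (pow_le_pow_left₀ (by positivity) (hloc x _ fun γ hγ => ?_) 2)
    by_contra h
    exact hγ (by rw [cut_apply, if_neg h])
  have hreal : (2 * c) ^ 2 * (F.card * ‖ψ‖ ^ 2) ≤
      F₁.card * ‖T ψ‖ ^ 2 + (F₃ \ F₁).card * (K * B.card * ‖ψ‖ ^ 2) := by
    rw [← ENNReal.ofReal_le_ofReal_iff (by positivity), ENNReal.ofReal_mul (by positivity),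
      ENNReal.ofReal_add (by positivity) (by positivity), ENNReal.ofReal_mul (by positivity),
      ENNReal.ofReal_mul (by positivity), ENNReal.ofReal_mul (Nat.cast_nonneg _),
      ENNReal.ofReal_natCast, ENNReal.ofReal_natCast, ENNReal.ofReal_natCast, ← hsum]
    exact hlower.trans hupper
  have hn1 : (0 : ℝ) < F₁.card := by exact_mod_cast hne.card_pos
  have hnF : (F₁.card : ℝ) ≤ F.card := by exact_mod_cast Finset.card_le_card h1F
  have hdiff : ((F₃ \ F₁).card : ℝ) ≤ 3 * c ^ 2 / (K * B.card + 1) * F₁.card := by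
    rw [Finset.cast_card_sdiff h13]
    linarith
  have hfin : (2 * c) ^ 2 * (F₁.card * ‖ψ‖ ^ 2) ≤
      F₁.card * ‖T ψ‖ ^ 2 + F₁.card * (3 * c ^ 2 * ‖ψ‖ ^ 2) := by
    calc (2 * c) ^ 2 * (F₁.card * ‖ψ‖ ^ 2) ≤ (2 * c) ^ 2 * (F.card * ‖ψ‖ ^ 2) := by gcongr
      _ ≤ _ := hreal
      _ ≤ F₁.card * ‖T ψ‖ ^ 2 +
          3 * c ^ 2 / (K * B.card + 1) * F₁.card * ((K * B.card + 1) * ‖ψ‖ ^ 2) := by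
          gcongr
          linarith
      _ = _ := by
          have : K * B.card + 1 ≠ 0 := by positivity
          field_simp
  have hsq : (c * ‖ψ‖) ^ 2 ≤ ‖T ψ‖ ^ 2 := by
    refine le_of_mul_le_mul_left ?_ hn1
    linarith
  exact (sq_le_sq₀ (by positivity) (norm_nonneg _)).1 hsq

end SquareSums

/-! ### Spectra of Schrödinger operators -/

section Continuity

variable {Γ A X : Type*} [TopologicalSpace A] [DiscreteTopology A] [Finite A] [PseudoMetricSpace X]

/-- A continuous function on a full shift is determined up to `ε` by finitely many coordinates. -/
lemma exists_finset_dist_le {f : (Γ → A) → X} (hf : Continuous f) {ε : ℝ} (hε : 0 < ε) :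
    ∃ K : Finset Γ, ∀ ω ρ : Γ → A, (∀ κ ∈ K, ω κ = ρ κ) → dist (f ω) (f ρ) ≤ ε := by
  classical
  have h1 : ∀ ω : Γ → A, ∃ K : Finset Γ, ∀ ρ, (∀ κ ∈ K, ρ κ = ω κ) → dist (f ρ) (f ω) < ε / 2 := by
    intro ω
    have hop : IsOpen (f ⁻¹' Metric.ball (f ω) (ε / 2)) := Metric.isOpen_ball.preimage hf
    obtain ⟨K, u, hu, hKu⟩ := isOpen_pi_iff.1 hop ω (by simpa using hε)
    exact ⟨K, fun ρ hρ => hKu fun κ hκ => by rw [hρ κ hκ]; exact (hu κ hκ).2⟩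
  choose K hK using h1
  have hopen : ∀ ω : Γ → A, IsOpen {ρ : Γ → A | ∀ κ ∈ K ω, ρ κ = ω κ} := by
    intro ω
    have : {ρ : Γ → A | ∀ κ ∈ K ω, ρ κ = ω κ} = (K ω : Set Γ).pi fun κ => {ω κ} := by
      ext; simp [Set.mem_pi]
    rw [this]
    exact isOpen_set_pi (K ω).finite_toSet fun _ _ => isOpen_discrete _
  obtain ⟨t, ht⟩ := isCompact_univ.elim_finite_subcover _ hopen
    fun ω _ => mem_iUnion.2 ⟨ω, fun _ _ => rfl⟩
  refine ⟨t.biUnion K, fun ω ρ h => ?_⟩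
  obtain ⟨σ, hσ, hωσ⟩ := mem_iUnion₂.1 (ht (mem_univ ω))
  have h2 := hK σ ω hωσ
  have h3 := hK σ ρ fun κ hκ => (h κ (Finset.mem_biUnion.2 ⟨σ, hσ, hκ⟩)).symm.trans (hωσ κ hκ)
  linarith [dist_triangle_right (f ω) (f ρ) (f σ)]

end Continuity

namespace SchrodingerOperator

variable {Γ A : Type*} [Group Γ] [TopologicalSpace A] [Finite A] (H : SchrodingerOperator Γ A)

/-- The shifted operator `H_ω - x`. -/
noncomputable def shifted (ω : Γ → A) (x : ℝ) :
    lp (fun _ : Γ => ℂ) 2 →L[ℂ] lp (fun _ : Γ => ℂ) 2 :=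
  H.op ω - algebraMap ℂ _ (x : ℂ)

lemma isSelfAdjoint_shifted (ω : Γ → A) (x : ℝ) : IsSelfAdjoint (H.shifted ω x) :=
  isSelfAdjoint_sub_real (H.isSelfAdjoint_op ω) x

lemma shifted_apply (ω : Γ → A) (x : ℝ) (ψ : lp (fun _ : Γ => ℂ) 2) (γ : Γ) :
    H.shifted ω x ψ γ = ∑ η ∈ H.range, H.coeff η (translate γ⁻¹ ω) * ψ (γ * η) - x * ψ γ := by
  rw [shifted, sub_apply, lp.coeFn_sub, Pi.sub_apply, op_apply,
    Algebra.algebraMap_eq_smul_one]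
  rfl

lemma notMem_spec_of_le {ω : Γ → A} {x c : ℝ} (hc : 0 < c)
    (h : ∀ ψ, c * ‖ψ‖ ≤ ‖H.shifted ω x ψ‖) : x ∉ H.spec ω := by
  have := isUnit_of_forall_le_norm (H.isSelfAdjoint_shifted ω x) hc h
  intro hx
  refine hx (spectrum.mem_resolventSet_iff.2 ?_)
  rw [← IsUnit.neg_iff, neg_sub]
  exact this

lemma le_norm_shifted {ω : Γ → A} {x c : ℝ} (hc : 0 < c)
    (h : ∀ y ∈ H.spec ω, c ≤ |x - y|) (ψ : lp (fun _ : Γ => ℂ) 2) :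
    c * ‖ψ‖ ≤ ‖H.shifted ω x ψ‖ := by
  refine le_norm_of_forall_spectrum (H.isSelfAdjoint_shifted ω x) hc (fun z hz => ?_) ψ
  have hz' : z + x ∈ spectrum ℂ (H.op ω) := by
    rw [shifted, ← spectrum.sub_singleton_eq] at hz
    obtain ⟨w, hw, _, rfl, rfl⟩ := hz
    simpa using hw
  -- The spectrum is real, so the hypothesis on `spec` controls all of it.
  have hre := (H.isSelfAdjoint_op ω).mem_spectrum_eq_re hz'
  have hmem : (z + x).re ∈ H.spec ω := by
    change (((z + x).re : ℝ) : ℂ) ∈ spectrum ℂ (H.op ω)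
    rwa [← hre]
  have hz2 : z = (((z + x).re - x : ℝ) : ℂ) := by
    push_cast
    rw [← hre]
    ring
  rw [hz2, Complex.norm_real, Real.norm_eq_abs, abs_sub_comm]
  exact h _ hmem

lemma exists_coeff_bound : ∃ C : ℝ, 0 ≤ C ∧ ∀ η ∈ H.range, ∀ ω, ‖H.coeff η ω‖ ≤ C := by
  have h : ∀ η, ∃ C : ℝ, η ∈ H.range → ∀ ω, ‖H.coeff η ω‖ ≤ C := by
    intro η
    by_cases hη : η ∈ H.range
    · obtain ⟨C, hC⟩ := isCompact_univ.exists_bound_of_continuousOn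
        (H.continuous_coeff η hη).continuousOn
      exact ⟨C, fun _ ω => hC ω (mem_univ _)⟩
    · exact ⟨0, fun h => absurd h hη⟩
  choose C hC using h
  refine ⟨∑ η ∈ H.range, |C η|, by positivity, fun η hη ω => ((hC η hη ω).trans (le_abs_self _)).trans
    (Finset.single_le_sum (f := fun η => |C η|) (fun _ _ => abs_nonneg _) hη)⟩

lemma norm_op_apply_le {C : ℝ} (hC0 : 0 ≤ C) (hC : ∀ η ∈ H.range, ∀ ω, ‖H.coeff η ω‖ ≤ C)
    (ω : Γ → A) (ψ : lp (fun _ : Γ => ℂ) 2) : ‖H.op ω ψ‖ ≤ C * H.range.card * ‖ψ‖ := by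
  refine (sq_le_sq₀ (norm_nonneg _) (by positivity)).1 ?_
  refine (norm_sq_le_of_apply_le H.range (K := C ^ 2 * H.range.card) (φ := ψ) (by positivity)
    fun γ => ?_).trans_eq (by ring)
  rw [op_apply]
  exact norm_sum_mul_sq_le _ _ (fun η => ψ (γ * η)) fun η hη _ => hC η hη _

open Classical in
lemma norm_shifted_apply_sq_le {C : ℝ} (hC0 : 0 ≤ C)
    (hC : ∀ η ∈ H.range, ∀ ω, ‖H.coeff η ω‖ ≤ C) {x b : ℝ} (hx : |x| ≤ b) (ω : Γ → A)
    (ψ : lp (fun _ : Γ => ℂ) 2) (γ : Γ) :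
    ‖H.shifted ω x ψ γ‖ ^ 2 ≤ (C + b) ^ 2 * (insert 1 H.range).card *
      ∑ η ∈ insert 1 H.range, ‖ψ (γ * η)‖ ^ 2 := by
  -- The identity need not lie in the range, so `-x` enters as a separate diagonal coefficient.
  have hrw : H.shifted ω x ψ γ = ∑ η ∈ insert 1 H.range,
      ((if η ∈ H.range then H.coeff η (translate γ⁻¹ ω) else 0) - if η = 1 then (x : ℂ) else 0)
        * ψ (γ * η) := by
    simp_rw [sub_mul, Finset.sum_sub_distrib, ite_mul, zero_mul]
    rw [shifted_apply, Finset.sum_ite_mem, Finset.sum_ite_eq', if_pos (Finset.mem_insert_self _ _),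
      mul_one, Finset.inter_eq_right.2 (Finset.subset_insert _ _)]
  rw [hrw]
  refine norm_sum_mul_sq_le _ _ (fun η => ψ (γ * η)) fun η _ _ => (norm_sub_le _ _).trans ?_
  have hb : 0 ≤ b := (abs_nonneg x).trans hx
  gcongr
  · split_ifs with h
    · exact hC η h _
    · simpa using hC0
  · split_ifs
    · rwa [Complex.norm_real, Real.norm_eq_abs]
    · simpa using hb

/-- Left translation is unitary and intertwines the two operators. -/
lemma le_norm_shifted_translate {ω : Γ → A} {x c : ℝ}
    (h : ∀ ψ, c * ‖ψ‖ ≤ ‖H.shifted ω x ψ‖) (g : Γ) (ψ : lp (fun _ : Γ => ℂ) 2) :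
    c * ‖ψ‖ ≤ ‖H.shifted (translate g ω) x ψ‖ := by
  have h2 : (0 : ℝ) < (2 : ℝ≥0∞).toReal := by norm_num
  let φ : lp (fun _ : Γ => ℂ) 2 := ⟨fun γ => ψ (g * γ), memℓp_gen
    ((lp.memℓp ψ).summable h2 |>.comp_injective (mul_right_injective g))⟩
  have hφ : ‖φ‖ = ‖ψ‖ := norm_eq_of_apply_equiv (Equiv.mulLeft g) fun γ => rfl
  have hT : ‖H.shifted ω x φ‖ = ‖H.shifted (translate g ω) x ψ‖ := by
    refine norm_eq_of_apply_equiv (Equiv.mulLeft g) fun γ => ?_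
    rw [shifted_apply, shifted_apply]
    have h1 : ∀ γ, φ γ = ψ (g * γ) := fun γ => rfl
    have h3 : translate (g * γ)⁻¹ (translate g ω) = translate γ⁻¹ ω := by
      funext ξ
      simp [translate, mul_assoc]
    rw [Equiv.coe_mulLeft, h3]
    simp only [h1, mul_assoc]
  rw [← hφ, ← hT]
  exact h φ

variable [DiscreteTopology A]

lemma exists_finset_coeff_close {ε : ℝ} (hε : 0 < ε) :
    ∃ K : Finset Γ, ∀ η ∈ H.range, ∀ ω ρ : Γ → A, (∀ κ ∈ K, ω κ = ρ κ) →
      ‖H.coeff η ω - H.coeff η ρ‖ ≤ ε := by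
  classical
  have h : ∀ η, ∃ K : Finset Γ, η ∈ H.range → ∀ ω ρ : Γ → A, (∀ κ ∈ K, ω κ = ρ κ) →
      ‖H.coeff η ω - H.coeff η ρ‖ ≤ ε := by
    intro η
    by_cases hη : η ∈ H.range
    · obtain ⟨K, hK⟩ := exists_finset_dist_le (H.continuous_coeff η hη) hε
      exact ⟨K, fun _ ω ρ hωρ => by rw [← dist_eq_norm]; exact hK ω ρ hωρ⟩
    · exact ⟨∅, fun h => absurd h hη⟩
  choose K hK using h
  exact ⟨H.range.biUnion K, fun η hη ω ρ hωρ => hK η hη ω ρ fun κ hκ =>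
    hωρ κ (Finset.mem_biUnion.2 ⟨η, hη, hκ⟩)⟩

/-- If all patches of `ω` on a sufficiently large finite set occur in `ρ`, then the spectrum of
`H_ω` is contained in the `ε`-neighbourhood of the spectrum of `H_ρ`. -/
theorem exists_finset_spec_close (hΓ : HasFolnerSets Γ) {ε : ℝ} (hε : 0 < ε) :
    ∃ F : Finset Γ, ∀ ω ρ : Γ → A, dictionaryOn ω F ⊆ dictionaryOn ρ F →
      ∀ x ∈ H.spec ω, ∃ y ∈ H.spec ρ, |x - y| ≤ ε := by
  classical
  obtain ⟨C, hC0, hC⟩ := H.exists_coeff_bound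
  set b := C * H.range.card with hb
  have hb0 : 0 ≤ b := by positivity
  -- With `c = ε / 4` the local bound required is `ε / 2`: the bound `ε` for `ρ` minus `ε / 2` for
  -- the change of coefficients.
  obtain ⟨F, hF⟩ := hΓ.exists_lower_bound (insert 1 H.range)
    (K := (C + b) ^ 2 * (insert 1 H.range).card) (c := ε / 4) (by positivity) (by positivity)
  set ε' := ε / (2 * (H.range.card + 1)) with hε'
  have hε'0 : 0 < ε' := by positivity
  obtain ⟨K, hK⟩ := H.exists_finset_coeff_close hε'0
  -- If a test function lives on `z F`, only coefficients at points of `z F B⁻¹` meet it, and these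
  -- are determined up to `ε'` by the letters on `z F B⁻¹ K`, where `B` is the range.
  refine ⟨F * H.range⁻¹ * K, fun ω ρ hωρ x hx => ?_⟩
  by_contra! hno
  -- `F` was fixed before `x`, so the constant of the finite-range bound must be uniform over the
  -- spectrum.
  have hxb : |x| ≤ b := by
    have h1 : ‖H.op ω‖ ≤ b :=
      ContinuousLinearMap.opNorm_le_bound _ hb0 (H.norm_op_apply_le hC0 hC ω)
    have h2 := spectrum.norm_le_norm_mul_of_mem
      (show (x : ℂ) ∈ spectrum ℂ (H.op ω) from hx)
    rw [Complex.norm_real, Real.norm_eq_abs] at h2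
    exact h2.trans ((mul_le_of_le_one_right (norm_nonneg _)
      ContinuousLinearMap.norm_id_le).trans h1)
  have hρ := H.le_norm_shifted hε fun y hy => (hno y hy).le
  refine H.notMem_spec_of_le (ω := ω) (x := x) (c := ε / 4) (by positivity) ?_ hx
  refine hF _ (H.norm_shifted_apply_sq_le hC0 hC hxb ω) fun z φ hφ => ?_
  obtain ⟨y, hy⟩ := mem_dictionaryOn.1 (hωρ (restrict_mem_dictionaryOn _ ω z))
  set ρ' := translate (z * y⁻¹) ρ with hρ'
  have hagree : ∀ κ ∈ F * H.range⁻¹ * K, ω (z * κ) = ρ' (z * κ) := fun κ hκ => by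
    have := hy ⟨κ, hκ⟩
    simp only at this
    rw [← this, hρ', translate]
    congr 1
    group
  have h1 := H.le_norm_shifted_translate hρ (z * y⁻¹) φ
  have hdiff : ‖H.shifted ω x φ - H.shifted ρ' x φ‖ ≤ ε / 2 * ‖φ‖ := by
    have h2 : ‖H.shifted ω x φ - H.shifted ρ' x φ‖ ≤ ε' * H.range.card * ‖φ‖ := by
      refine (sq_le_sq₀ (norm_nonneg _) (by positivity)).1 ?_
      refine (norm_sq_le_of_apply_le H.range (K := ε' ^ 2 * H.range.card) (φ := φ) (by positivity)
        fun γ => ?_).trans_eq (by ring)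
      rw [lp.coeFn_sub, Pi.sub_apply, shifted_apply, shifted_apply, sub_sub_sub_cancel_right,
        ← Finset.sum_sub_distrib]
      simp_rw [← sub_mul]
      refine norm_sum_mul_sq_le _ _ (fun η => φ (γ * η)) fun η hη h0 => hK η hη _ _ fun κ hκ => ?_
      have hmem : z⁻¹ * (γ * η) * η⁻¹ * κ ∈ F * H.range⁻¹ * K :=
        Finset.mul_mem_mul (Finset.mul_mem_mul (hφ _ h0) (Finset.inv_mem_inv hη)) hκ
      have h3 := hagree _ hmem
      have h4 : z * (z⁻¹ * (γ * η) * η⁻¹ * κ) = γ⁻¹⁻¹ * κ := by group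
      rwa [h4] at h3
    refine h2.trans ?_
    gcongr
    rw [hε', div_mul_eq_mul_div, div_le_div_iff₀ (by positivity) (by positivity)]
    nlinarith
  have h5 := norm_sub_norm_le (H.shifted ρ' x φ) (H.shifted ω x φ)
  rw [norm_sub_rev] at h5
  linarith

/-- The potential that indicates the occurrences of a patch. -/
noncomputable def indicator (F : Finset Γ) (P : F → A) : SchrodingerOperator Γ A where
  range := {1}
  inv_mem := by simp
  coeff _ ω := by
    classical
    exact if (fun κ : F => ω κ) = P then 1 else 0
  continuous_coeff _ _ := by
    classical
    have h1 : Continuous fun ω : Γ → A => fun κ : F => ω κ :=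
      continuous_pi fun κ => continuous_apply _
    exact (continuous_of_discreteTopology (f := fun Q : F → A => if Q = P then (1 : ℂ) else 0)).comp
      h1
  coeff_symm η hη ω := by
    rw [Finset.mem_singleton] at hη
    subst hη
    have : translate (1 : Γ)⁻¹ ω = ω := by funext; simp [translate]
    rw [this]
    split_ifs <;> simp

open Classical in
lemma op_indicator_apply (F : Finset Γ) (P : F → A) (ω : Γ → A)
    (ψ : lp (fun _ : Γ => ℂ) 2) (γ : Γ) :
    (indicator F P).op ω ψ γ = if ∀ κ : F, ω (γ * κ) = P κ then ψ γ else 0 := by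
  rw [op_apply]
  simp [indicator, translate, funext_iff]

/-- The delta function at an occurrence of `P` is an eigenvector for the eigenvalue `1`. -/
lemma one_mem_spec_indicator {F : Finset Γ} {P : F → A} {ω : Γ → A} (h : P ∈ dictionaryOn ω F) :
    1 ∈ (indicator F P).spec ω := by
  classical
  obtain ⟨γ, hγ⟩ := mem_dictionaryOn.1 h
  intro hu
  have hv : (algebraMap ℂ _ ((1 : ℝ) : ℂ) - (indicator F P).op ω) (lp.single 2 γ (1 : ℂ)) = 0 := by
    ext ξ
    rw [sub_apply, lp.coeFn_sub, Pi.sub_apply, op_indicator_apply]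
    by_cases hξ : ξ = γ
    · subst hξ
      rw [if_pos hγ]
      simp
    · simp [Pi.single_eq_of_ne hξ]
  obtain ⟨u, hu⟩ := hu
  have hv2 := congrArg (fun φ => (↑u⁻¹ : lp (fun _ : Γ => ℂ) 2 →L[ℂ] lp (fun _ : Γ => ℂ) 2) φ) hv
  beta_reduce at hv2
  rw [← hu, ← mul_apply_eq_comp, Units.inv_mul, one_apply_eq_self,
    map_zero] at hv2
  have := congrArg (fun φ : lp (fun _ : Γ => ℂ) 2 => φ γ) hv2
  simp at this

lemma spec_indicator_subset {F : Finset Γ} {P : F → A} {ω : Γ → A} (h : P ∉ dictionaryOn ω F) :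
    (indicator F P).spec ω ⊆ {0} := by
  classical
  have h0 : (indicator F P).op ω = 0 := by
    ext ψ γ
    rw [op_indicator_apply, if_neg fun hγ => h (mem_dictionaryOn.2 ⟨γ, hγ⟩)]
    rfl
  intro x hx
  by_contra hne
  refine hx (spectrum.mem_resolventSet_iff.2 ?_)
  rw [h0, sub_zero]
  exact (IsUnit.mk0 (x : ℂ) (by exact_mod_cast hne)).map (algebraMap ℂ _)

/-- If `P` were missing in `ρ`, the spectrum there would lie in `{0}`, at distance `1` from the
point `1` of the other spectrum. -/
lemma dictionaryOn_of_hausdorffEDist_lt {F : Finset Γ} {P : F → A} {ω ρ : Γ → A}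
    (h : Metric.hausdorffEDist ((indicator F P).spec ω) ((indicator F P).spec ρ) < 1)
    (hP : P ∈ dictionaryOn ω F) : P ∈ dictionaryOn ρ F := by
  by_contra hno
  obtain ⟨y, hy, hd⟩ := Metric.exists_edist_lt_of_hausdorffEDist_lt (one_mem_spec_indicator hP) h
  rw [mem_singleton_iff.1 (spec_indicator_subset hno hy), edist_dist] at hd
  simp at hd

end SchrodingerOperator

/-! ### The metric on configurations -/

section ConfigMetric

variable {Γ A : Type*} [Group Γ] [MetricSpace Γ]

lemma configMetric_dist_le {ω ρ : Γ → A} {r : ℝ} (hr : 0 ≤ r)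
    (h : ∀ γ ∈ Metric.ball (1 : Γ) r, ω γ = ρ γ) : (configMetric Γ A).dist ω ρ ≤ 1 / (r + 1) :=
  csInf_le (agreeSet_bddBelow ω ρ) ⟨r, hr, h, rfl⟩

lemma eq_of_configMetric_dist_lt {ω ρ : Γ → A} {r : ℝ}
    (h : (configMetric Γ A).dist ω ρ < 1 / (r + 1)) (hr : 0 ≤ r) :
    ∀ γ ∈ Metric.ball (1 : Γ) r, ω γ = ρ γ := by
  obtain ⟨_, ⟨r', hr', h1, rfl⟩, hlt⟩ := exists_lt_of_csInf_lt (agreeSet_nonempty ω ρ) h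
  rw [one_div_lt_one_div (by positivity) (by positivity)] at hlt
  exact fun γ hγ => h1 γ (Metric.ball_subset_ball (by linarith) hγ)

lemma subshiftDist_le {Ω₁ Ω₂ : Set (Γ → A)} {r : ℝ} (hr : 0 ≤ r)
    (h₁ : ∀ ω ∈ Ω₁, ∃ ρ ∈ Ω₂, ∀ γ ∈ Metric.ball (1 : Γ) r, ω γ = ρ γ)
    (h₂ : ∀ ω ∈ Ω₂, ∃ ρ ∈ Ω₁, ∀ γ ∈ Metric.ball (1 : Γ) r, ω γ = ρ γ) :
    subshiftDist Ω₁ Ω₂ ≤ ENNReal.ofReal (1 / (r + 1)) := by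
  let := configMetric Γ A
  have key : ∀ ω ρ : Γ → A, (∀ γ ∈ Metric.ball (1 : Γ) r, ω γ = ρ γ) →
      edist ω ρ ≤ ENNReal.ofReal (1 / (r + 1)) := fun ω ρ h => by
    rw [edist_dist]
    exact ENNReal.ofReal_le_ofReal (configMetric_dist_le hr h)
  refine Metric.hausdorffEDist_le_of_mem_edist (fun ω hω => ?_) fun ω hω => ?_
  · obtain ⟨ρ, hρ, h⟩ := h₁ ω hω
    exact ⟨ρ, hρ, key _ _ h⟩
  · obtain ⟨ρ, hρ, h⟩ := h₂ ω hω
    exact ⟨ρ, hρ, key _ _ h⟩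

lemma exists_eq_on_ball_of_subshiftDist_lt {Ω₁ Ω₂ : Set (Γ → A)} {r : ℝ} (hr : 0 ≤ r)
    (h : subshiftDist Ω₁ Ω₂ < ENNReal.ofReal (1 / (r + 1))) {ω : Γ → A} (hω : ω ∈ Ω₁) :
    ∃ ρ ∈ Ω₂, ∀ γ ∈ Metric.ball (1 : Γ) r, ω γ = ρ γ := by
  let := configMetric Γ A
  obtain ⟨ρ, hρ, hd⟩ := Metric.exists_edist_lt_of_hausdorffEDist_lt hω h
  rw [edist_dist, ENNReal.ofReal_lt_ofReal_iff (by positivity)] at hd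
  exact ⟨ρ, hρ, eq_of_configMetric_dist_lt hd hr⟩

end ConfigMetric

lemma mem_orbit_iff {Γ A : Type*} [Group Γ] {ω ρ : Γ → A} :
    ρ ∈ orbit ω ↔ ∃ γ, ∀ η, ρ η = ω (γ * η) := by
  constructor
  · rintro ⟨γ, rfl⟩
    exact ⟨γ⁻¹, fun η => rfl⟩
  · rintro ⟨γ, h⟩
    exact ⟨γ⁻¹, by funext η; simp [translate, h]⟩

lemma restrict_mem_dictionaryOn_of_mem_closure_orbit {Γ A : Type*} [Group Γ] [TopologicalSpace A]
    [DiscreteTopology A] {ω ρ : Γ → A} (h : ρ ∈ closure (orbit ω)) (F : Finset Γ) :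
    (fun η : F => ρ η) ∈ dictionaryOn ω F := by
  have hopen : IsOpen ((F : Set Γ).pi fun η => {ρ η}) :=
    isOpen_set_pi F.finite_toSet fun _ _ => isOpen_discrete _
  obtain ⟨σ, hσ, hσ'⟩ := mem_closure_iff.1 h _ hopen fun η _ => rfl
  obtain ⟨γ, hγ⟩ := mem_orbit_iff.1 hσ'
  exact mem_dictionaryOn.2 ⟨γ, fun η => by rw [← hγ]; exact hσ η η.2⟩

/-! ### Paths in finite directed graphs -/

/-- A path without closed subpaths is shorter than the number of vertices. -/
lemma length_lt_card_of_not_hasClosedSubpath {X : Type*} [Finite X] {Gr : Digraph X} {l : ℕ}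
    {p : Fin (l + 1) → X} (hp : IsPath Gr p) (h : ¬ HasClosedSubpath Gr p) : l < Nat.card X := by
  by_contra hl
  -- A path of length `l` has `l + 1` entries, more than there are vertices.
  have hninj : ¬ Function.Injective p := fun hinj => by
    have := Nat.card_le_card_of_injective p hinj
    rw [Nat.card_eq_fintype_card, Fintype.card_fin] at this
    omega
  obtain ⟨i, j, hij, hlt⟩ : ∃ i j, p i = p j ∧ i < j := by
    simp only [Function.Injective, not_forall] at hninj
    obtain ⟨i, j, hij, hne⟩ := hninj
    rcases lt_or_gt_of_ne hne with h | h
    · exact ⟨i, j, hij, h⟩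
    · exact ⟨j, i, hij.symm, h⟩
  have hj := j.2
  have hlt' : (i : ℕ) < j := hlt
  refine h ⟨j - i, fun k => p ⟨i + k, by omega⟩, ⟨by omega, fun k => ?_⟩, ?_,
    i, by omega, fun k => rfl⟩
  · exact hp.2 ⟨i + k, by omega⟩
  · simp only [Fin.val_zero, Fin.val_last, add_zero]
    rw [Fin.eta, hij]
    congr 1
    ext
    simp
    omega

/-! ### Equivalence of the conditions -/

namespace SubstitutionDatum

variable {G : Type*} [Group G] [MetricSpace G] {𝒟 : DilationDatum G} {A : Type*}
  (𝒮 : SubstitutionDatum 𝒟 A)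

/-- For each finite set `F` and all large `n`, the patches of `S^n(ω₀)` on `F` are exactly the legal
ones. -/
def PatchConvergence (ω₀ : 𝒟.lattice → A) : Prop :=
  ∀ F : Finset 𝒟.lattice, ∀ᶠ n in atTop, ∀ P : F → A,
    P ∈ dictionaryOn (𝒮.substConfig^[n] ω₀) F ↔ finPatch P ∈ 𝒮.legal

variable {𝒮} [Finite A] [TopologicalSpace A] [DiscreteTopology A]

lemma PatchConvergence.spectralConvergence (hprim : 𝒮.IsPrimitive) {ω₀ : 𝒟.lattice → A}
    (h : 𝒮.PatchConvergence ω₀) : 𝒮.SpectralConvergence ω₀ := by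
  intro H ω hω
  rw [ENNReal.tendsto_nhds_zero]
  intro ε hε
  obtain ⟨δ, hδ, hδε⟩ := ENNReal.lt_iff_exists_nnreal_btwn.1 hε
  have hδ0 : (0 : ℝ) < δ := by exact_mod_cast hδ
  have hΓ := 𝒟.hasFolnerSets 𝒮.isStretchFactor.one_lt
  obtain ⟨F, hF⟩ := H.exists_finset_spec_close hΓ hδ0
  filter_upwards [h F] with n hn
  have heq : dictionaryOn (𝒮.substConfig^[n] ω₀) F = dictionaryOn ω F := by
    ext P
    rw [hn, hprim.mem_dictionaryOn_iff hω]
  refine le_trans ?_ hδε.le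
  have key : ∀ x y : ℝ, |x - y| ≤ δ → edist x y ≤ δ := fun x y hxy => by
    rw [edist_dist, Real.dist_eq, ← ENNReal.ofReal_coe_nnreal]
    exact ENNReal.ofReal_le_ofReal hxy
  refine Metric.hausdorffEDist_le_of_mem_edist (fun x hx => ?_) fun x hx => ?_
  · obtain ⟨y, hy, hxy⟩ := hF _ _ heq.subset x hx
    exact ⟨y, hy, key _ _ hxy⟩
  · obtain ⟨y, hy, hxy⟩ := hF _ _ heq.symm.subset x hx
    exact ⟨y, hy, key _ _ hxy⟩

/-- There are finitely many patches on `F`, and for each one the spectrum of its indicator potential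
decides whether it occurs; `ω` in `Ω(S)` supplies exactly the legal ones. -/
lemma SpectralConvergence.patchConvergence (hprim : 𝒮.IsPrimitive) {ω₀ : 𝒟.lattice → A}
    (h : 𝒮.SpectralConvergence ω₀) : 𝒮.PatchConvergence ω₀ := by
  have : Nonempty A := ⟨ω₀ 1⟩
  obtain ⟨ω, hω⟩ := 𝒮.subshift_nonempty
  intro F
  rw [eventually_all]
  intro P
  filter_upwards [(h (SchrodingerOperator.indicator F P) ω hω).eventually_lt_const one_pos]
    with n hn
  rw [← hprim.mem_dictionaryOn_iff hω]
  refine ⟨SchrodingerOperator.dictionaryOn_of_hausdorffEDist_lt hn,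
    SchrodingerOperator.dictionaryOn_of_hausdorffEDist_lt ?_⟩
  rwa [Metric.hausdorffEDist_comm]

lemma PatchConvergence.subshiftConvergence (hprim : 𝒮.IsPrimitive) {ω₀ : 𝒟.lattice → A}
    (h : 𝒮.PatchConvergence ω₀) : 𝒮.SubshiftConvergence ω₀ := by
  have : Nonempty A := ⟨ω₀ 1⟩
  obtain ⟨ω, hω⟩ := 𝒮.subshift_nonempty
  have key : ∀ r : ℕ, ∀ᶠ n in atTop,
      subshiftDist (closure (orbit (𝒮.substConfig^[n] ω₀))) 𝒮.subshift ≤ ENNReal.ofReal (1 / ((r : ℝ) + 1)) := by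
    intro r
    set F := (𝒟.finite_ball 1 r).toFinset with hF
    have memF : ∀ γ, γ ∈ Metric.ball (1 : 𝒟.lattice) r → γ ∈ F := fun γ hγ => by
      simpa [hF] using hγ
    filter_upwards [h F] with n hn
    refine subshiftDist_le (Nat.cast_nonneg r) (fun ρ hρ => ?_) fun ρ hρ => ?_
    · have h1 := (hn _).1 (restrict_mem_dictionaryOn_of_mem_closure_orbit hρ F)
      obtain ⟨x, hx⟩ := mem_dictionaryOn.1 ((hprim.mem_dictionaryOn_iff hω).2 h1)
      -- A translate of `ω` stays in `Ω(S)`, as its patches are patches of `ω`.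
      refine ⟨fun η => ω (x * η), fun P hP => hω ⟨hP.1, ?_⟩,
        fun γ hγ => (hx ⟨γ, memF γ hγ⟩).symm⟩
      refine hP.2.trans (isSubpatch_iff.2 ⟨x, fun η a ha => ha⟩)
    · have h1 := (hprim.mem_dictionaryOn_iff hρ).1 (restrict_mem_dictionaryOn F ρ 1)
      obtain ⟨x, hx⟩ := mem_dictionaryOn.1 ((hn _).2 h1)
      refine ⟨fun η => 𝒮.substConfig^[n] ω₀ (x * η),
        subset_closure (mem_orbit_iff.2 ⟨x, fun η => rfl⟩), fun γ hγ => ?_⟩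
      simpa using (hx ⟨γ, memF γ hγ⟩).symm
  rw [SubshiftConvergence, ENNReal.tendsto_nhds_zero]
  intro ε hε
  have hlim : Tendsto (fun r : ℕ => ENNReal.ofReal (1 / ((r : ℝ) + 1))) atTop (𝓝 0) := by
    simpa using ENNReal.tendsto_ofReal (tendsto_one_div_add_atTop_nhds_zero_nat (𝕜 := ℝ))
  obtain ⟨r, hr⟩ := (hlim.eventually_lt_const hε).exists
  filter_upwards [key r] with n hn using hn.trans hr.le

omit [Finite A] [DiscreteTopology A] in
lemma SubshiftConvergence.eventually_legal {ω₀ : 𝒟.lattice → A} (h : 𝒮.SubshiftConvergence ω₀)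
    (F : Finset 𝒟.lattice) :
    ∀ᶠ n in atTop, ∀ P ∈ dictionaryOn (𝒮.substConfig^[n] ω₀) F, finPatch P ∈ 𝒮.legal := by
  obtain ⟨r, hr0, hr⟩ : ∃ r : ℝ, 0 ≤ r ∧ ∀ η ∈ F, dist η 1 < r :=
    ⟨∑ η ∈ F, dist η 1 + 1, by positivity, fun η hη =>
      (Finset.single_le_sum (f := fun η => dist η 1) (fun _ _ => dist_nonneg) hη).trans_lt
        (lt_add_one _)⟩
  have hpos : 0 < ENNReal.ofReal (1 / (r + 1)) := ENNReal.ofReal_pos.2 (by positivity)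
  filter_upwards [h.eventually_lt_const hpos] with n hn P hP
  obtain ⟨x, hx⟩ := mem_dictionaryOn.1 hP
  obtain ⟨ρ, hρ, hρ'⟩ := exists_eq_on_ball_of_subshiftDist_lt hr0 hn
    (subset_closure (mem_orbit_iff.2 ⟨x, fun η => rfl⟩))
  refine hρ (mem_dictionaryOn.2 ⟨1, fun η => ?_⟩)
  rw [one_mul, ← hρ' η (Metric.mem_ball.2 (hr η η.2))]
  exact hx η

omit [Finite A] [TopologicalSpace A] [DiscreteTopology A] in
/-- Along a path in the substitution graph, the later vertices occur in substituted configurations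
in which the earlier ones occur. -/
lemma isSubpatch_of_path {T : Finset 𝒟.lattice} {N : ℕ} {v : ℕ → T → A} {k : ℕ}
    (hv : ∀ i < k, IsSubpatch (finPatch (v (i + 1))) (𝒮.substPatch^[N] (finPatch (v i)))) :
    IsSubpatch (finPatch (v k)) (𝒮.substPatch^[N * k] (finPatch (v 0))) := by
  induction k with
  | zero => exact isSubpatch_iff.2 ⟨1, fun η a ha => by simpa using ha⟩
  | succ k ih =>
    refine (hv k (by omega)).trans ?_
    rw [Nat.mul_succ, Nat.add_comm, Function.iterate_add_apply]
    exact 𝒮.isSubpatch_substPatch_iterate N (ih fun i hi => hv i (by omega))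

-- A vertex of a closed path of length `m` recurs in itself after `N m` substitutions. Once reached
-- from `ω₀` it occurs in `S^n(ω₀)` for unboundedly many `n`, since `N m ≥ 1`, although it is
-- illegal.
omit [Finite A] [DiscreteTopology A] in
lemma SubshiftConvergence.noClosedPaths {ω₀ : 𝒟.lattice → A} (h : 𝒮.SubshiftConvergence ω₀)
    {T : Finset 𝒟.lattice} {N : ℕ} (hN : 1 ≤ N) : 𝒮.NoClosedPaths T N ω₀ := by
  rintro l p hp hp0 ⟨m, q, hq, hclosed, i, him, hqp⟩
  have h1 : IsSubpatch (finPatch (q 0)) (𝒮.substPatch^[N * i] (finPatch (p 0))) := by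
    have := isSubpatch_of_path (𝒮 := 𝒮) (T := T) (N := N) (k := i)
      -- The finite path is extended to all of `ℕ`; the default value is never reached.
      (v := fun j => if hj : j ≤ l then p ⟨j, by omega⟩ else p 0) fun j hj => by
        have hj1 : j + 1 ≤ l := by omega
        have hj2 : j ≤ l := by omega
        simp only [hj1, hj2, dif_pos]
        exact (hp.2 ⟨j, by omega⟩).1
    have hi : i ≤ l := by omega
    simp only [hi, dif_pos, Nat.zero_le] at this
    have hq0 : q 0 = p ⟨i, by omega⟩ := hqp 0
    rw [hq0]
    exact this
  have h2 : IsSubpatch (finPatch (q 0)) (𝒮.substPatch^[N * m] (finPatch (q 0))) := by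
    have := isSubpatch_of_path (𝒮 := 𝒮) (T := T) (N := N) (k := m)
      (v := fun j => if hj : j ≤ m then q ⟨j, by omega⟩ else q 0) fun j hj => by
        have hj1 : j + 1 ≤ m := by omega
        have hj2 : j ≤ m := by omega
        simp only [hj1, hj2, dif_pos]
        exact (hq.2 ⟨j, by omega⟩).1
    simp only [le_refl, dif_pos, Nat.zero_le] at this
    rw [show (⟨m, by omega⟩ : Fin (m + 1)) = Fin.last m from rfl, ← hclosed] at this
    exact this
  have h3 : ∀ j : ℕ, IsSubpatch (finPatch (q 0))
      (𝒮.substPatch^[N * i + N * m * j] (configPatch ω₀)) := by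
    intro j
    induction j with
    | zero => exact h1.trans (𝒮.isSubpatch_substPatch_iterate _ hp0.2)
    | succ j ih =>
      rw [show N * i + N * m * (j + 1) = N * m + (N * i + N * m * j) by ring,
        Function.iterate_add_apply]
      exact h2.trans (𝒮.isSubpatch_substPatch_iterate _ ih)
  obtain ⟨n, hn⟩ := (h.eventually_legal T).exists_forall_of_atTop
  have hle : n ≤ N * i + N * m * n := by
    have : 1 ≤ N * m := Nat.mul_pos hN hq.1
    nlinarith
  have h4 := h3 n
  rw [substPatch_iterate_configPatch] at h4
  have hm := hq.1
  exact (hq.2 ⟨0, by omega⟩).2.1 (hn _ hle (q 0) ⟨finPatch_supp_finite _, h4⟩)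

omit [TopologicalSpace A] [DiscreteTopology A] in
lemma NoClosedPaths.shortPaths {ω₀ : 𝒟.lattice → A} {T : Finset 𝒟.lattice} {N : ℕ}
    (h : 𝒮.NoClosedPaths T N ω₀) : 𝒮.ShortPaths T N ω₀ :=
  fun l p hp hp0 => length_lt_card_of_not_hasClosedSubpath hp (h l p hp hp0)

omit [Finite A] [TopologicalSpace A] [DiscreteTopology A] in
/-- An illegal patch on `T` in `S^(N k) ω₀` comes from a path of illegal patches. -/
lemma exists_path_of_not_legal {ω₀ : 𝒟.lattice → A} {T : Finset 𝒟.lattice} {N : ℕ}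
    (hT : 𝒟.Covers 𝒮.stretch T N) (k : ℕ) {P : T → A}
    (hP : P ∈ dictionaryOn (𝒮.substConfig^[N * k] ω₀) T) (hleg : finPatch P ∉ 𝒮.legal) :
    ∃ v : ℕ → T → A, v 0 ∈ dictionaryOn ω₀ T ∧ v k = P ∧
      ∀ i < k, (𝒮.graph T N).Adj (v i) (v (i + 1)) := by
  induction k generalizing P with
  | zero => exact ⟨fun _ => P, hP, rfl, by simp⟩
  | succ k ih =>
    rw [Nat.mul_succ, Nat.add_comm, Function.iterate_add_apply] at hP
    obtain ⟨Q, hQ, hPQ⟩ := 𝒮.exists_isSubpatch_of_inflate (fun x => by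
      obtain ⟨γ, hγ⟩ := hT x
      exact ⟨γ, (𝒮.smul_subset_smul_inflate_iff N _ _ x γ).1 hγ⟩) hP
    have hQleg : finPatch Q ∉ 𝒮.legal := fun h =>
      hleg (𝒮.legal_of_isSubpatch_substPatch N (finPatch_supp_finite _) hPQ h)
    obtain ⟨v, hv0, hvk, hv⟩ := ih hQ hQleg
    refine ⟨fun i => if i ≤ k then v i else P, by simpa using hv0, by simp, fun i hi => ?_⟩
    rcases Nat.lt_succ_iff_lt_or_eq.1 hi with hi | rfl
    · have h1 : i ≤ k := hi.le
      have h2 : i + 1 ≤ k := hi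
      simp only [h1, h2, if_true]
      exact hv i hi
    · simp only [le_refl, if_true, Nat.not_succ_le_self, if_false, hvk]
      exact ⟨hPQ, hQleg, hleg⟩

omit [TopologicalSpace A] [DiscreteTopology A] in
lemma ShortPaths.patchConvergence (hprim : 𝒮.IsPrimitive) {ω₀ : 𝒟.lattice → A}
    {T : Finset 𝒟.lattice} {N : ℕ} (hT : 𝒟.IsTestingTuple 𝒮.stretch T N)
    (h : 𝒮.ShortPaths T N ω₀) : 𝒮.PatchConvergence ω₀ := by
  have : Nonempty A := ⟨ω₀ 1⟩
  set m := Nat.card (T → A) with hm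
  -- Paths have length at least `1` by definition, so the forbidden length `m` must be positive.
  have hm1 : 1 ≤ m := Nat.card_pos
  have hlegal : ∀ Q ∈ dictionaryOn (𝒮.substConfig^[N * m] ω₀) T, finPatch Q ∈ 𝒮.legal := by
    intro Q hQ
    by_contra hno
    obtain ⟨v, hv0, -, hv⟩ := exists_path_of_not_legal hT.isLeast.1.2 m hQ hno
    exact absurd (h m (fun i => v i) ⟨hm1, fun i => hv i i.2⟩ hv0) (lt_irrefl _)
  intro F
  obtain ⟨r, hr0, hr⟩ : ∃ r : ℝ, 0 < r ∧ ∀ η ∈ F, dist η 1 < r :=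
    ⟨∑ η ∈ F, dist η 1 + 1, by positivity, fun η hη =>
      (Finset.single_le_sum (f := fun η => dist η 1) (fun _ _ => dist_nonneg) hη).trans_lt
        (lt_add_one _)⟩
  obtain ⟨Nr, hNr⟩ := hT.testing r hr0
  rw [eventually_all]
  intro P
  have hback : ∀ᶠ n in atTop, finPatch P ∈ 𝒮.legal →
      P ∈ dictionaryOn (𝒮.substConfig^[n] ω₀) F := by
    by_cases hP : finPatch P ∈ 𝒮.legal
    · filter_upwards [hprim.eventually_mem_dictionary hP ω₀] with n hn _ using hn
    · exact Eventually.of_forall fun n h => absurd h hP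
  filter_upwards [hback, eventually_ge_atTop (Nr + N * m)] with n hn hle
  refine ⟨fun hP => ?_, hn⟩
  obtain ⟨j, rfl⟩ := Nat.exists_eq_add_of_le hle
  -- The inner `N m` substitutions make all `T`-patches legal; the outer `Nr + j` are enough for
  -- property (a) to cover every translate of `F` by an inflated translate of `T`.
  rw [show Nr + N * m + j = (Nr + j) + N * m by ring, Function.iterate_add_apply] at hP
  obtain ⟨Q, hQ, hPQ⟩ := 𝒮.exists_isSubpatch_of_inflate (fun x => by
    obtain ⟨γ, hγ⟩ := hNr (Nr + j) (by omega) x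
    exact ⟨γ, fun η hη => (𝒮.smul_subset_smul_inflate_iff _ _ _ x γ).1 hγ η
      (Metric.mem_ball.2 (hr η hη))⟩) hP
  exact 𝒮.legal_of_isSubpatch_substPatch _ (finPatch_supp_finite _) hPQ (hlegal Q hQ)

end SubstitutionDatum

end SubstLattice

theorem mainTheorem1 {G : Type*} [Group G] [MetricSpace G] (𝒟 : SubstLattice.DilationDatum G)
    {A : Type*} [Finite A] [TopologicalSpace A] [DiscreteTopology A]
    (𝒮 : SubstLattice.SubstitutionDatum 𝒟 A) (hprim : 𝒮.IsPrimitive)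
    (T : Finset 𝒟.lattice) (N : ℕ) (hT : 𝒟.IsTestingTuple 𝒮.stretch T N)
    (ω₀ : 𝒟.lattice → A) :
    [𝒮.SpectralConvergence ω₀,
      𝒮.SubshiftConvergence ω₀,
      𝒮.NoClosedPaths T N ω₀,
      𝒮.ShortPaths T N ω₀].TFAE ∧
    ((∀ P ∈ SubstLattice.dictionaryOn ω₀ T, SubstLattice.finPatch P ∈ 𝒮.legal) →
      𝒮.SpectralConvergence ω₀ ∧ 𝒮.SubshiftConvergence ω₀ ∧
        𝒮.NoClosedPaths T N ω₀ ∧ 𝒮.ShortPaths T N ω₀) := by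
  have htfae : [𝒮.SpectralConvergence ω₀, 𝒮.SubshiftConvergence ω₀,
      𝒮.NoClosedPaths T N ω₀, 𝒮.ShortPaths T N ω₀].TFAE := by
    tfae_have 1 → 2 := fun h => (h.patchConvergence hprim).subshiftConvergence hprim
    tfae_have 2 → 3 := fun h => h.noClosedPaths hT.isLeast.1.1
    tfae_have 3 → 4 := fun h => h.shortPaths
    tfae_have 4 → 1 := fun h => (h.patchConvergence hprim hT).spectralConvergence hprim
    tfae_finish
  refine ⟨htfae, fun h => ?_⟩
  -- Edges join illegal vertices and paths have at least one edge, so no path starts in a legal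
  -- patch.
  have h3 : 𝒮.NoClosedPaths T N ω₀ := fun l p hp hp0 _ => (hp.2 ⟨0, hp.1⟩).2.1 (h _ hp0)
  exact ⟨(htfae.out 0 2).2 h3, (htfae.out 1 2).2 h3, h3, h3.shortPaths⟩
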